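/- Let $(W,S)$ be a Coxeter system of rank $n$, $S=\{s_1,\dots,s_n\}$, with $W$ infinite and irreducible (connected Coxeter graph) and Coxeter matrix $(m_{ij})$, $m_{ij}\in\mathbb Z_{\ge 1}\cup\{\infty\}$. Let $V=\mathbb R^n$ be the Euclidean space with orthonormal basis $\Delta=\{\alpha_1,\dots,\alpha_n\}$, and let $B$ be a symmetric bilinear form on $V$ with $B(\alpha_i,\alpha_j)=-\cos(\pi/m_{ij})$ if $m_{ij}<\infty$ and $B(\alpha_i,\alpha_j)$ an arbitrary real number $\le -1$ if $m_{ij}=\infty$. Assume that $B$ has signature $(n-1,1)$. Let $W$ act on $V$ by letting $s_i$ act as $v\mapsto v-2\frac{B(\alpha_i,v)}{B(\alpha_i,\alpha_i)}\alpha_i$, and let $\Phi=W(\Delta)$ be the root system. Let $o=\sum_i o_i\alpha_i$ be an eigenvector of Euclidean norm $1$ of the matrix $(B(\alpha_i,\alpha_j))_{i,j}$ for its negative eigenvalue (it is unique up to sign; the sign may be chosen arbitrarily, for instance so that all $o_i>0$). Put $|v|_1=\sum_i o_iv_i$ for $v=\sum_i v_i\alpha_i$, $V_1=\{v\in V:|v|_1=1\}$,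 and $\widehat v=v/|v|_1$ when $|v|_1\neq0$. Let $\widehat\Delta=\{\widehat{\alpha_1},\dots,\widehat{\alpha_n}\}$, $\widehat Q=\{x\in V_1: B(x,x)=0\}$, and let $E$ be the set of accumulation points in $V$ of the set $\{\widehat\rho:\rho\in\Phi\}$. For $w\in W$ and $x\in\widehat Q$ let $w\cdot x=\widehat{w(x)}$, and for $D\subset\widehat Q$ let $W\cdot D=\{w\cdot x: w\in W,\ x\in D\}$. Then: (a) If $\widehat Q\subset\operatorname{conv}(\widehat\Delta)$, then $E=\widehat Q$. (b) If $\widehat Q\not\subset\operatorname{conv}(\widehat\Delta)$, then $\widehat Q\setminus\operatorname{conv}(\widehat\Delta)$ has finitely many connected components $D_1,\dots,D_m$, where $1\le m\le n$, and $$E=\widehat Q\setminus\bigcup_{i=1}^m W\cdot D_i .$$ -/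

import Mathlib

open Set Filter Topology

noncomputable section

namespace CoxeterRoots

/-- The Euclidean space `V = ℝⁿ`, whose standard orthonormal basis plays the role of the set of
simple roots. -/
abbrev V (n : ℕ) : Type := EuclideanSpace ℝ (Fin n)

variable {n : ℕ}

/-- The simple root `α_i`: the `i`-th vector of the standard orthonormal basis. -/
def simpleRoot (i : Fin n) : V n := EuclideanSpace.basisFun (Fin n) ℝ i

/-- The bilinear form on `V` whose matrix in the basis of simple roots is `B`. -/
def form (B : Matrix (Fin n) (Fin n) ℝ) : LinearMap.BilinForm ℝ (V n) :=
  Matrix.toBilin (EuclideanSpace.basisFun (Fin n) ℝ).toBasis B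

theorem form_simpleRoot (B : Matrix (Fin n) (Fin n) ℝ) (i j : Fin n) :
    form B (simpleRoot i) (simpleRoot j) = B i j := by
  have h := LinearMap.BilinForm.toMatrix_apply (EuclideanSpace.basisFun (Fin n) ℝ).toBasis
    (form B) i j
  rw [form, LinearMap.BilinForm.toMatrix_toBilin] at h
  simpa only [simpleRoot, OrthonormalBasis.coe_toBasis, form] using h.symm

/-- `B` is an admissible matrix of the bilinear form for the Coxeter matrix `M`
(in Mathlib, the entry `0` of a `CoxeterMatrix` stands for `∞`):
`B i j = -cos (π / m_ij)` if `m_ij < ∞`, and `B i j ≤ -1` is arbitrary if `m_ij = ∞`. -/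
structure IsCoxeterForm (M : CoxeterMatrix (Fin n)) (B : Matrix (Fin n) (Fin n) ℝ) : Prop where
  symm : B.IsSymm
  finite_entry : ∀ i j, M i j ≠ 0 → B i j = -Real.cos (Real.pi / (M i j : ℝ))
  infinite_entry : ∀ i j, M i j = 0 → B i j ≤ -1

/-- The Coxeter graph is connected: the simple reflections cannot be split into two nonempty sets
that commute with each other. -/
def IsIrreducible (M : CoxeterMatrix (Fin n)) : Prop :=
  ∀ I : Set (Fin n), I.Nonempty → Iᶜ.Nonempty → ∃ i ∈ I, ∃ j ∈ Iᶜ, M i j ≠ 2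

/-- The form with matrix `B` has signature `(p, q)`, in the sense that a maximal positive definite
subspace has dimension `p` and a maximal negative definite subspace has dimension `q`. -/
def HasSignature (B : Matrix (Fin n) (Fin n) ℝ) (p q : ℕ) : Prop :=
  sigPos (form B).toQuadraticMap = p ∧
    sigNeg (form B).toQuadraticMap = q

section Reflections

variable {M : CoxeterMatrix (Fin n)} {B : Matrix (Fin n) (Fin n) ℝ}

theorem IsCoxeterForm.diag (hB : IsCoxeterForm M B) (i : Fin n) : B i i = 1 := by
  have h := hB.finite_entry i i (by simp)
  simpa using h

theorem IsCoxeterForm.two (hB : IsCoxeterForm M B) (i : Fin n) :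
    ((2 : ℝ) • form B (simpleRoot i)) (simpleRoot i) = 2 := by
  simp [form_simpleRoot, hB.diag i]

/-- The `B`-reflection in the simple root `α_i`. -/
def simpleReflection (hB : IsCoxeterForm M B) (i : Fin n) : V n ≃ₗ[ℝ] V n :=
  Module.reflection (hB.two i)

theorem simpleReflection_apply (hB : IsCoxeterForm M B) (i : Fin n) (v : V n) :
    simpleReflection hB i v = v - (2 * (form B (simpleRoot i) v /
      form B (simpleRoot i) (simpleRoot i))) • simpleRoot i := by
  simp [simpleReflection, Module.reflection_apply, form_simpleRoot, hB.diag i]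

/-- The `B`-reflections in the simple roots satisfy the Coxeter relations. -/
theorem isLiftable_simpleReflection (hB : IsCoxeterForm M B) :
    M.IsLiftable (simpleReflection hB) := by
  intro i j
  rcases eq_or_ne (M i j) 0 with h0 | h0
  · rw [h0, pow_zero]
  rcases eq_or_ne i j with rfl | hij
  · rw [CoxeterMatrix.diagonal, pow_one]
    exact mul_eq_one_iff_eq_inv.mpr (Module.reflection_inv _).symm
  have h1 := M.off_diagonal i j hij
  have hm2 : 2 ≤ M i j := by omega
  have hb := hB.finite_entry i j h0
  have hfy : ((2 : ℝ) • form B (simpleRoot i)) (simpleRoot j) = 2 * B i j := by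
    simp [form_simpleRoot]
  have hgx : ((2 : ℝ) • form B (simpleRoot j)) (simpleRoot i) = 2 * B i j := by
    simp [form_simpleRoot, hB.symm.apply i j]
  generalize M i j = m at *
  rcases eq_or_ne m 2 with rfl | hm
  · have hb0 : B i j = 0 := by rw [hb]; simp
    rw [hb0, mul_zero] at hfy hgx
    ext1 z
    have hi := hB.two i
    have hj := hB.two j
    simp only [pow_two, LinearEquiv.mul_apply, simpleReflection, Module.reflection_apply,
      map_sub, map_smul, hfy, hgx, hi, hj, LinearEquiv.coe_one, id]
    module
  have hm3 : 3 ≤ m := by omega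
  set θ : ℝ := 2 * (Real.pi / m) with hθ
  have hmR : (3 : ℝ) ≤ m := by exact_mod_cast hm3
  have hmpos : (0 : ℝ) < m := by linarith
  have hsin : Real.sin θ ≠ 0 := by
    apply ne_of_gt
    apply Real.sin_pos_of_pos_of_lt_pi
    · have := Real.pi_pos
      positivity
    · have h3 : Real.pi / m ≤ Real.pi / 3 :=
        div_le_div_of_nonneg_left Real.pi_pos.le (by norm_num) hmR
      have := Real.pi_pos
      linarith
  have hmθ : (m : ℝ) * θ = 2 * Real.pi := by
    rw [hθ]; field_simp
  have ht : 2 * Real.cos θ = ((2 : ℝ) • form B (simpleRoot i)) (simpleRoot j) *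
      ((2 : ℝ) • form B (simpleRoot j)) (simpleRoot i) - 2 := by
    rw [hfy, hgx, hb, hθ, Real.cos_two_mul]; ring
  ext1 z
  have key := Module.reflection_mul_reflection_pow_apply (hB.two i) (hB.two j) m z
    (2 * Real.cos θ) ht
  have hS := fun k : ℤ => Polynomial.Chebyshev.S_two_mul_real_cos θ k
  have hc1 : ((Polynomial.Chebyshev.S ℝ (((m : ℤ) - 2) / 2)).eval (2 * Real.cos θ) *
      ((Polynomial.Chebyshev.S ℝ (((m : ℤ) - 1) / 2)).eval (2 * Real.cos θ) +
        (Polynomial.Chebyshev.S ℝ (((m : ℤ) - 3) / 2)).eval (2 * Real.cos θ))) = 0 ∧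
      ((Polynomial.Chebyshev.S ℝ (((m : ℤ) - 1) / 2)).eval (2 * Real.cos θ) *
      ((Polynomial.Chebyshev.S ℝ ((m : ℤ) / 2)).eval (2 * Real.cos θ) +
        (Polynomial.Chebyshev.S ℝ (((m : ℤ) - 2) / 2)).eval (2 * Real.cos θ))) = 0 := by
    rcases Nat.even_or_odd' m with ⟨k, hk | hk⟩
    · have e1 : ((m : ℤ) - 2) / 2 = (k : ℤ) - 1 := by omega
      have e2 : ((m : ℤ) - 1) / 2 = (k : ℤ) - 1 := by omega
      have hz : (Polynomial.Chebyshev.S ℝ ((k : ℤ) - 1)).eval (2 * Real.cos θ) = 0 := by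
        have h := hS ((k : ℤ) - 1)
        have hkθ : (k : ℝ) * θ = Real.pi := by
          rw [hk] at hmθ; push_cast at hmθ; linarith
        push_cast at h
        rw [sub_add_cancel, hkθ, Real.sin_pi] at h
        exact (mul_eq_zero.mp h).resolve_right hsin
      rw [e1, e2, hz]; simp
    · have e1 : ((m : ℤ) - 2) / 2 = (k : ℤ) - 1 := by omega
      have e2 : ((m : ℤ) - 1) / 2 = (k : ℤ) := by omega
      have e3 : ((m : ℤ) - 3) / 2 = (k : ℤ) - 1 := by omega
      have e4 : (m : ℤ) / 2 = (k : ℤ) := by omega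
      have hz : (Polynomial.Chebyshev.S ℝ (k : ℤ)).eval (2 * Real.cos θ) +
          (Polynomial.Chebyshev.S ℝ ((k : ℤ) - 1)).eval (2 * Real.cos θ) = 0 := by
        have h := hS ((k : ℤ) - 1)
        have h' := hS (k : ℤ)
        have hkθ : ((k : ℝ) + 1) * θ = 2 * Real.pi - k * θ := by
          rw [hk] at hmθ; push_cast at hmθ; linarith
        push_cast at h h'
        rw [sub_add_cancel] at h
        rw [hkθ, Real.sin_two_pi_sub] at h'
        refine (mul_eq_zero.mp ?_).resolve_right hsin
        rw [add_mul, h, h']; ring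
      rw [e1, e2, e3, e4, hz]; simp
  rw [hc1.1, hc1.2, zero_smul, zero_smul, add_zero, add_zero] at key
  exact key

variable {W : Type*} [Group W]

/-- The action of the Coxeter group `W` on `V` by compositions of `B`-reflections, i.e. the
homomorphism that sends each Coxeter generator `s_i` to the `B`-reflection in `α_i`. -/
def action (cs : CoxeterSystem M W) (hB : IsCoxeterForm M B) : W →* (V n ≃ₗ[ℝ] V n) :=
  cs.lift ⟨simpleReflection hB, isLiftable_simpleReflection hB⟩

theorem action_simple (cs : CoxeterSystem M W) (hB : IsCoxeterForm M B) (i : Fin n) :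
    action cs hB (cs.simple i) = simpleReflection hB i :=
  cs.lift_apply_simple (isLiftable_simpleReflection hB) i

/-- The root system `Φ = W(Δ)`. -/
def roots (cs : CoxeterSystem M W) (hB : IsCoxeterForm M B) : Set (V n) :=
  {v | ∃ (w : W) (i : Fin n), v = action cs hB w (simpleRoot i)}

end Reflections

/-- `o` is a Euclidean unit eigenvector of the matrix `B` for a negative eigenvalue. -/
def IsUnitNegEigenvector (B : Matrix (Fin n) (Fin n) ℝ) (o : V n) : Prop :=
  ‖o‖ = 1 ∧ ∃ c : ℝ, c < 0 ∧ Matrix.toEuclideanLin B o = c • o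

/-- `|v|₁ = ∑ i, o_i v_i`. -/
def height (o v : V n) : ℝ := ∑ i, o i * v i

/-- The normalized vector `v / |v|₁` (used only where `|v|₁ ≠ 0`). -/
def normalize (o v : V n) : V n := (height o v)⁻¹ • v

/-- The affine hyperplane `V₁ = {v : |v|₁ = 1}`. -/
def V₁ (o : V n) : Set (V n) := {v | height o v = 1}

/-- The normalized isotropic cone `{x ∈ V₁ : B(x, x) = 0}`. -/
def isotropic (B : Matrix (Fin n) (Fin n) ℝ) (o : V n) : Set (V n) :=
  {x | x ∈ V₁ o ∧ form B x x = 0}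

/-- The convex hull of the normalized simple roots. -/
def simplex (o : V n) : Set (V n) :=
  convexHull ℝ (range fun i : Fin n => normalize o (simpleRoot i))

section Orbits

variable {M : CoxeterMatrix (Fin n)} {B : Matrix (Fin n) (Fin n) ℝ} {W : Type*} [Group W]

/-- The set `E` of accumulation points of the set of normalized roots. -/
def limitRoots (cs : CoxeterSystem M W) (hB : IsCoxeterForm M B) (o : V n) : Set (V n) :=
  {x | AccPt x (𝓟 (normalize o '' roots cs hB))}

/-- The normalized action `w · x`, the normalization of `w(x)`. -/
def normalizedAction (cs : CoxeterSystem M W) (hB : IsCoxeterForm M B) (o : V n) (w : W)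
    (x : V n) : V n :=
  normalize o (action cs hB w x)

/-- The set `W · D` of all `w · x` with `w ∈ W` and `x ∈ D`. -/
def orbit (cs : CoxeterSystem M W) (hB : IsCoxeterForm M B) (o : V n) (D : Set (V n)) :
    Set (V n) :=
  ⋃ w : W, normalizedAction cs hB o w '' D

end Orbits

/-- The set of connected components of a subset `A` of `V`, as subsets of `V`. -/
def components (A : Set (V n)) : Set (Set (V n)) := connectedComponentIn A '' A

end CoxeterRoots

end

/-!
The heart of the matter is the description (`limitRoots_eq`)

  `E = {x ∈ Q̂ | w · x ∈ conv Δ̂ for all w ∈ W}`,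

from which both cases follow formally, because `W` acts on `Q̂` (`normalizedAction_mul`). The bound
on the number of components holds because `Q̂ \ conv Δ̂` is the union over `i` of the caps
`{x ∈ Q̂ | o_i x_i < 0}`, and each cap is connected (`isPreconnected_cap`).

*Preliminaries.* By a Perron-Frobenius argument all `o_i` have the same sign (`pos_or_neg`), and by
replacing `o` with `-o` they may be taken positive. By the signature assumption `B` is positive
definite on the orthogonal complement of `o`; hence for `x, y ∈ Q̂` one has `B(x, y) ≤ 0`, with
equality only for `x = y`. Every root is positive or negative (`action_simpleRoot_nonneg`), and so
an element of `W` acting almost trivially on `V` is trivial. Applied to products of two reflections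
this shows that bounded sets contain finitely many roots (`finite_roots_norm_le`).

*Limit roots.* Normalized roots lie in `conv Δ̂`, their heights tend to infinity, and `W` permutes
them. So `E` is contained in `Q̂ ∩ conv Δ̂` and stable under `W`, which is one inclusion.

*The converse.* The tool is `mem_limitRoots_of_bounded_form`: if `|B(ρ, x)|` is bounded for `ρ` in
an infinite set of roots, then the corresponding normalized roots accumulate at a point of `Q̂` that
is orthogonal to `x`, that is, at `x`. Let the orbit of `x ∈ Q̂` stay in `conv Δ̂`. If infinitely
many `w(x)` have height at most that of `x`, these `w(x)` are bounded, so the roots `w⁻¹(α_i)` have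
bounded pairing `B(α_i, w(x))` with `x`, and the tool applies. Otherwise some `y = w(x)` has minimal
height, so `B(α_i, y) ≤ 0` for all `i`. As `y` has nonnegative coordinates and is isotropic, it is
orthogonal to all `α_i` in its support, and hence to the subsystem of roots they generate, which is
infinite since a root of maximal height in it would be orthogonal to the whole subsystem.
-/

open Set Filter Topology

noncomputable section

namespace CoxeterRoots

section

variable {n : ℕ}

/-! ### Coordinates and the bilinear form -/

theorem simpleRoot_apply (i j : Fin n) : (simpleRoot i : V n) j = if j = i then 1 else 0 := by
  simp [simpleRoot, PiLp.single_apply]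

theorem sum_smul_simpleRoot (v : V n) : ∑ i, v i • simpleRoot i = v := by
  ext j
  simp [simpleRoot_apply]

theorem form_eq_sum_left (B : Matrix (Fin n) (Fin n) ℝ) (x y : V n) :
    form B x y = ∑ i, x i * form B (simpleRoot i) y := by
  conv_lhs => rw [← sum_smul_simpleRoot x]
  simp

theorem form_eq_sum_right (B : Matrix (Fin n) (Fin n) ℝ) (x y : V n) :
    form B x y = ∑ i, y i * form B x (simpleRoot i) := by
  conv_lhs => rw [← sum_smul_simpleRoot y]
  simp

theorem form_eq_sum (B : Matrix (Fin n) (Fin n) ℝ) (x y : V n) :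
    form B x y = ∑ i, ∑ j, x i * (y j * B i j) := by
  rw [form_eq_sum_left]
  simp_rw [form_eq_sum_right B (simpleRoot _) y, form_simpleRoot, Finset.mul_sum]

@[fun_prop]
theorem continuous_form {X : Type*} [TopologicalSpace X] (B : Matrix (Fin n) (Fin n) ℝ)
    {f g : X → V n} (hf : Continuous f) (hg : Continuous g) :
    Continuous fun x => form B (f x) (g x) := by
  simp_rw [form_eq_sum]
  fun_prop

variable {M : CoxeterMatrix (Fin n)} {B : Matrix (Fin n) (Fin n) ℝ}

theorem IsCoxeterForm.form_comm (hB : IsCoxeterForm M B) (x y : V n) :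
    form B x y = form B y x := by
  rw [form_eq_sum, form_eq_sum, Finset.sum_comm]
  refine Finset.sum_congr rfl fun i _ => Finset.sum_congr rfl fun j _ => ?_
  rw [hB.symm.apply i j]
  ring

theorem simpleReflection_eq (hB : IsCoxeterForm M B) (i : Fin n) (v : V n) :
    simpleReflection hB i v = v - (2 * form B (simpleRoot i) v) • simpleRoot i := by
  rw [simpleReflection_apply, form_simpleRoot, hB.diag, div_one]

theorem form_simpleReflection (hB : IsCoxeterForm M B) (i : Fin n) (x y : V n) :
    form B (simpleReflection hB i x) (simpleReflection hB i y) = form B x y := by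
  simp only [simpleReflection_eq, map_sub, map_smul, LinearMap.sub_apply, LinearMap.smul_apply,
    smul_eq_mul, form_simpleRoot, hB.diag, hB.form_comm x (simpleRoot i)]
  ring

theorem IsCoxeterForm.nonpos_of_ne (hB : IsCoxeterForm M B) {i j : Fin n} (hij : i ≠ j) :
    B i j ≤ 0 := by
  by_cases h0 : M i j = 0
  · linarith [hB.infinite_entry i j h0]
  · have h1 := M.off_diagonal i j hij
    have h2 : (2 : ℝ) ≤ M i j := by exact_mod_cast (by omega : 2 ≤ M i j)
    rw [hB.finite_entry i j h0, neg_nonpos]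
    have h3 : Real.pi / M i j ≤ Real.pi / 2 :=
      div_le_div_of_nonneg_left Real.pi_pos.le (by norm_num) h2
    have h4 : 0 ≤ Real.pi / M i j := by positivity
    exact Real.cos_nonneg_of_mem_Icc ⟨by linarith [Real.pi_pos], h3⟩

/-- The coefficients of the roots of a dihedral subsystem, as long as the alternating words that
produce them are reduced, are nonnegative. -/
theorem IsCoxeterForm.chebyshev_nonneg (hB : IsCoxeterForm M B) {i j : Fin n} (hij : i ≠ j)
    {k : ℕ} (hk : M i j ≠ 0 → k < M i j) :
    0 ≤ (Polynomial.Chebyshev.S ℝ k).eval (-(2 * B i j)) := by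
  by_cases h0 : M i j = 0
  · have ha := hB.infinite_entry i j h0
    set a := -(2 * B i j) with ha'
    have ha2 : 2 ≤ a := by linarith
    have key : ∀ k : ℕ, 0 ≤ (Polynomial.Chebyshev.S ℝ k).eval a ∧
        (Polynomial.Chebyshev.S ℝ k).eval a ≤
          (Polynomial.Chebyshev.S ℝ ((k : ℤ) + 1)).eval a := by
      intro k
      induction k with
      | zero => simp; linarith
      | succ k ih =>
        have h := Polynomial.Chebyshev.S_add_two ℝ (k : ℤ)
        have h' : (Polynomial.Chebyshev.S ℝ ((k : ℤ) + 1 + 1)).eval a =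
            a * (Polynomial.Chebyshev.S ℝ ((k : ℤ) + 1)).eval a -
              (Polynomial.Chebyshev.S ℝ (k : ℤ)).eval a := by
          rw [show (k : ℤ) + 1 + 1 = k + 2 by ring, h]; simp
        push_cast
        refine ⟨ih.1.trans ih.2, ?_⟩
        rw [h']
        nlinarith [ih.1, ih.2]
    exact (key k).1
  · have h1 := M.off_diagonal i j hij
    have hk := hk h0
    have h2 : (2 : ℝ) ≤ M i j := by exact_mod_cast (by omega : 2 ≤ M i j)
    have hkm : (k : ℝ) + 1 ≤ M i j := by exact_mod_cast hk
    have hm : (0 : ℝ) < M i j := by linarith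
    set θ := Real.pi / M i j with hθ
    have hθm : M i j * θ = Real.pi := by rw [hθ]; field_simp
    have hθ0 : 0 < θ := div_pos Real.pi_pos hm
    have hsin : 0 < Real.sin θ := Real.sin_pos_of_pos_of_lt_pi hθ0 (by nlinarith)
    have h := Polynomial.Chebyshev.S_two_mul_real_cos θ k
    rw [hB.finite_entry i j h0, show -(2 * -Real.cos (Real.pi / M i j)) = 2 * Real.cos θ by
      rw [hθ]; ring]
    refine nonneg_of_mul_nonneg_left ?_ hsin
    rw [h]
    apply Real.sin_nonneg_of_nonneg_of_le_pi
    · push_cast; positivity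
    · push_cast
      calc ((k : ℝ) + 1) * θ ≤ M i j * θ := by gcongr
        _ = Real.pi := hθm

/-! ### Positive and negative roots -/

variable {W : Type*} [Group W]

theorem form_action (cs : CoxeterSystem M W) (hB : IsCoxeterForm M B) (w : W) (x y : V n) :
    form B (action cs hB w x) (action cs hB w y) = form B x y := by
  induction w using cs.simple_induction_left with
  | one => simp
  | mul_simple_left w i ih =>
    rw [map_mul, LinearEquiv.mul_apply, LinearEquiv.mul_apply, action_simple,
      form_simpleReflection, ih]

theorem action_simple_simpleRoot (cs : CoxeterSystem M W) (hB : IsCoxeterForm M B) (i : Fin n) :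
    action cs hB (cs.simple i) (simpleRoot i) = -simpleRoot i := by
  rw [action_simple, simpleReflection_eq, form_simpleRoot, hB.diag]
  module

/-- The alternating word of length `k` in `s_i, s_j` that ends in `s_j` sends `α_i` to a combination
of `α_i` and `α_j` whose coefficients are values of Chebyshev polynomials. -/
theorem action_alternatingWord (cs : CoxeterSystem M W) (hB : IsCoxeterForm M B) (i j : Fin n)
    (k : ℕ) :
    action cs hB (cs.wordProd (CoxeterSystem.alternatingWord i j k)) (simpleRoot i) =
      if Even k then
        (Polynomial.Chebyshev.S ℝ k).eval (-(2 * B i j)) • simpleRoot i +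
          (Polynomial.Chebyshev.S ℝ ((k : ℤ) - 1)).eval (-(2 * B i j)) • simpleRoot j
      else
        (Polynomial.Chebyshev.S ℝ ((k : ℤ) - 1)).eval (-(2 * B i j)) • simpleRoot i +
          (Polynomial.Chebyshev.S ℝ k).eval (-(2 * B i j)) • simpleRoot j := by
  induction k with
  | zero => simp [CoxeterSystem.alternatingWord]
  | succ k ih =>
    have hS : (Polynomial.Chebyshev.S ℝ ((k : ℤ) + 1)).eval (-(2 * B i j)) =
        -(2 * B i j) * (Polynomial.Chebyshev.S ℝ (k : ℤ)).eval (-(2 * B i j)) -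
          (Polynomial.Chebyshev.S ℝ ((k : ℤ) - 1)).eval (-(2 * B i j)) := by
      rw [Polynomial.Chebyshev.S_add_one]; simp
    rw [CoxeterSystem.alternatingWord_succ', cs.wordProd_cons, map_mul, LinearEquiv.mul_apply, ih,
      action_simple, simpleReflection_eq]
    push_cast
    rw [add_sub_cancel_right, hS]
    by_cases hk : Even k
    · simp only [hk, if_true, Nat.even_add_one, not_true, if_false, map_add, map_smul,
        form_simpleRoot, hB.diag, hB.symm.apply i j, smul_eq_mul]
      module
    · simp only [hk, if_false, Nat.even_add_one, not_false_eq_true, if_true, map_add, map_smul,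
        form_simpleRoot, hB.diag, smul_eq_mul]
      module

/-- If right multiplication by `s_i` lengthens `w`, then `w(α_i)` is a positive root. The proof is
by induction on the length of `w`: one removes from the right of `w` the longest alternating word in
`s_i` and a second generator `s_j` that shortens `w`, and computes in the dihedral group
generated by `s_i` and `s_j`. -/
theorem action_simpleRoot_nonneg (cs : CoxeterSystem M W) (hB : IsCoxeterForm M B) (w : W)
    (i : Fin n) (h : ¬ cs.IsRightDescent w i) :
    ∀ l, 0 ≤ action cs hB w (simpleRoot i) l := by
  induction hN : cs.length w using Nat.strong_induction_on generalizing w i with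
  | _ N IH =>
  subst hN
  by_cases hw : w = 1
  · subst hw
    intro l
    simp only [map_one, LinearEquiv.coe_one, id, simpleRoot_apply]
    split_ifs <;> norm_num
  obtain ⟨j, hj⟩ := cs.exists_rightDescent_of_ne_one hw
  have hij : i ≠ j := fun hij => h (hij ▸ hj)
  set b : ℕ → W := fun k => cs.wordProd (CoxeterSystem.alternatingWord i j k) with hb
  have hb0 : b 0 = 1 := by simp [hb, CoxeterSystem.alternatingWord]
  have hbs : ∀ k, w * (b (k + 1))⁻¹ = w * (b k)⁻¹ * cs.simple (if Even k then j else i) := by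
    intro k
    simp only [hb]
    rw [CoxeterSystem.alternatingWord_succ', cs.wordProd_cons, mul_inv_rev, cs.inv_simple,
      mul_assoc]
  let P : ℕ → Prop := fun k => cs.length (w * (b k)⁻¹) + k = cs.length w
  have hP0 : P 0 := by simp [P, hb0]
  have hPle : ∀ k, P k → k ≤ cs.length w := fun k hk => by simp only [P] at hk; omega
  have hPs : ∀ k, P (k + 1) → P k := by
    intro k hk
    have h1 : cs.length (w * (b (k + 1))⁻¹) + (k + 1) = cs.length w := hk
    have h2 := cs.length_mul_simple (w * (b k)⁻¹) (if Even k then j else i)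
    rw [← hbs] at h2
    have h3 := cs.length_le_length_mul_add_right w (b k)⁻¹
    have h4 := cs.length_wordProd_le (CoxeterSystem.alternatingWord i j k)
    rw [CoxeterSystem.length_alternatingWord] at h4
    rw [cs.length_inv] at h3
    change cs.length (w * (b k)⁻¹) + k = cs.length w
    change cs.length (b k) ≤ k at h4
    omega
  have hPmono : ∀ k m, m ≤ k → P k → P m := by
    intro k m hmk hk
    induction k, hmk using Nat.le_induction with
    | base => exact hk
    | succ k _ ih => exact ih (hPs k hk)
  classical
  set k := Nat.findGreatest P (cs.length w) with hk
  have hPk : P k := Nat.findGreatest_spec (m := 0) (Nat.zero_le _) hP0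
  have hPk1 : ¬ P (k + 1) := by
    intro hc
    have := Nat.le_findGreatest (hPle _ hc) hc
    omega
  have hP1 : P 1 := by
    have h1 := hbs 0
    rw [hb0] at h1
    simp only [inv_one, mul_one, Even.zero, if_true, zero_add] at h1
    change cs.length (w * (b 1)⁻¹) + 1 = cs.length w
    rw [h1]
    exact (cs.isRightDescent_iff).1 hj
  have hk1 : 1 ≤ k := Nat.le_findGreatest (hPle _ hP1) hP1
  set v := w * (b k)⁻¹ with hv
  have hvlen : cs.length v + k = cs.length w := hPk
  -- By maximality of `k`, neither `s_i` nor `s_j` shortens `v`.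
  have hnext : ¬ cs.IsRightDescent v (if Even k then j else i) := by
    intro hc
    have h1 := cs.isRightDescent_iff.1 hc
    rw [hv, ← hbs] at h1
    apply hPk1
    change cs.length (w * (b (k + 1))⁻¹) + (k + 1) = cs.length w
    rw [← hvlen, hv]
    omega
  have hlast : ¬ cs.IsRightDescent v (if Even k then i else j) := by
    intro hc
    have h1 := cs.isRightDescent_iff.1 hc
    obtain ⟨m, hm⟩ : ∃ m, k = m + 1 := ⟨k - 1, by omega⟩
    have h2 := hbs m
    have h3 : (if Even k then i else j) = if Even m then j else i := by
      rw [hm]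
      by_cases hme : Even m <;> simp [hme, Nat.even_add_one]
    have h4 : P m := hPs m (hm ▸ hPk)
    change cs.length (w * (b m)⁻¹) + m = cs.length w at h4
    rw [hv, hm, ← hm, h3, hm, h2, cs.simple_mul_simple_cancel_right] at h1
    rw [← h2, ← hm, ← hv] at h1
    omega
  have hvi : ∀ l, 0 ≤ action cs hB v (simpleRoot i) l := by
    refine IH (cs.length v) (by omega) v i ?_ rfl
    by_cases hke : Even k
    · simpa [hke] using hlast
    · simpa [hke] using hnext
  have hvj : ∀ l, 0 ≤ action cs hB v (simpleRoot j) l := by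
    refine IH (cs.length v) (by omega) v j ?_ rfl
    by_cases hke : Even k
    · simpa [hke] using hnext
    · simpa [hke] using hlast
  -- The braid relation bounds `k`, since otherwise `s_i` would shorten `w`.
  have hkm : M i j ≠ 0 → k < M i j := by
    intro h0
    by_contra hc
    push Not at hc
    have hm : P (M i j) := hPmono k _ hc hPk
    obtain ⟨m, hm'⟩ : ∃ m, M i j = m + 1 := ⟨M i j - 1, by omega⟩
    have h1 : b (M i j) = cs.wordProd (CoxeterSystem.alternatingWord i j m) * cs.simple i := by
      have h2 := cs.wordProd_braidWord_eq i j
      rw [CoxeterSystem.braidWord, CoxeterSystem.braidWord, M.symmetric j i] at h2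
      rw [hb]
      simp only
      rw [h2, hm', CoxeterSystem.alternatingWord_succ, cs.wordProd_concat]
    have h3 : w * (b (M i j))⁻¹ = (w * cs.simple i) * (b m)⁻¹ := by
      rw [h1, mul_inv_rev, cs.inv_simple, ← mul_assoc]
    have h4 := cs.length_le_length_mul_add_right (w * cs.simple i) (b m)⁻¹
    have h5 := cs.length_wordProd_le (CoxeterSystem.alternatingWord i j m)
    rw [CoxeterSystem.length_alternatingWord] at h5
    rw [cs.length_inv] at h4
    change cs.length (b m) ≤ m at h5
    change cs.length (w * (b (M i j))⁻¹) + M i j = cs.length w at hm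
    have h6 := cs.not_isRightDescent_iff.1 h
    rw [h3] at hm
    omega
  have hwv : w = v * b k := by rw [hv]; group
  have hc1 : 0 ≤ (Polynomial.Chebyshev.S ℝ k).eval (-(2 * B i j)) := hB.chebyshev_nonneg hij hkm
  have hc2 : 0 ≤ (Polynomial.Chebyshev.S ℝ ((k : ℤ) - 1)).eval (-(2 * B i j)) := by
    have h1 := hB.chebyshev_nonneg hij (k := k - 1) (fun h0 => by have := hkm h0; omega)
    rwa [Nat.cast_sub hk1, Nat.cast_one] at h1
  intro l
  rw [hwv, map_mul, LinearEquiv.mul_apply, hb]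
  simp only
  rw [action_alternatingWord]
  split_ifs
  · simp only [map_add, map_smul, PiLp.add_apply, PiLp.smul_apply, smul_eq_mul]
    exact add_nonneg (mul_nonneg hc1 (hvi l)) (mul_nonneg hc2 (hvj l))
  · simp only [map_add, map_smul, PiLp.add_apply, PiLp.smul_apply, smul_eq_mul]
    exact add_nonneg (mul_nonneg hc2 (hvi l)) (mul_nonneg hc1 (hvj l))

theorem action_simpleRoot_nonpos (cs : CoxeterSystem M W) (hB : IsCoxeterForm M B) (w : W)
    (i : Fin n) (h : cs.IsRightDescent w i) (l : Fin n) :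
    action cs hB w (simpleRoot i) l ≤ 0 := by
  have h1 := action_simpleRoot_nonneg cs hB (w * cs.simple i) i
    (cs.isRightDescent_iff_not_isRightDescent_mul.1 h) l
  rw [map_mul, LinearEquiv.mul_apply, action_simple_simpleRoot, map_neg, PiLp.neg_apply] at h1
  linarith

/-- Every root is positive or negative. -/
theorem roots_nonneg_or_nonpos (cs : CoxeterSystem M W) (hB : IsCoxeterForm M B) {ρ : V n}
    (hρ : ρ ∈ roots cs hB) : (∀ l, 0 ≤ ρ l) ∨ ∀ l, ρ l ≤ 0 := by
  obtain ⟨w, i, rfl⟩ := hρ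
  by_cases h : cs.IsRightDescent w i
  · exact Or.inr (action_simpleRoot_nonpos cs hB w i h)
  · exact Or.inl (action_simpleRoot_nonneg cs hB w i h)

/-- An element of `W` whose action is close to the identity is trivial. -/
theorem eq_one_of_forall_pos (cs : CoxeterSystem M W) (hB : IsCoxeterForm M B) {w : W}
    (h : ∀ i, 0 < action cs hB w (simpleRoot i) i) : w = 1 := by
  by_contra hw
  obtain ⟨i, hi⟩ := cs.exists_rightDescent_of_ne_one hw
  exact absurd (action_simpleRoot_nonpos cs hB w i hi i) (not_le.2 (h i))

theorem eq_of_forall_action_inv_eq (cs : CoxeterSystem M W) (hB : IsCoxeterForm M B) {w w' : W}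
    (h : ∀ i, action cs hB w⁻¹ (simpleRoot i) = action cs hB w'⁻¹ (simpleRoot i)) : w = w' := by
  have h1 : w' * w⁻¹ = 1 := by
    refine eq_one_of_forall_pos cs hB fun i => ?_
    rw [map_mul, LinearEquiv.mul_apply, h, ← LinearEquiv.mul_apply, ← map_mul, mul_inv_cancel,
      map_one]
    simp [simpleRoot_apply]
  exact (mul_inv_eq_one.1 h1).symm

end

section

variable {n : ℕ}

/-! ### The height function and normalization -/

section Height

variable (o : V n)

@[simp]
theorem height_add (v w : V n) : height o (v + w) = height o v + height o w := by
  simp [height, mul_add, Finset.sum_add_distrib]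

@[simp]
theorem height_smul (a : ℝ) (v : V n) : height o (a • v) = a * height o v := by
  simp only [height, PiLp.smul_apply, smul_eq_mul, Finset.mul_sum]
  exact Finset.sum_congr rfl fun i _ => by ring

@[simp]
theorem height_neg (v : V n) : height o (-v) = -height o v := by
  rw [← neg_one_smul ℝ v, height_smul, neg_one_mul]

@[simp]
theorem height_sub (v w : V n) : height o (v - w) = height o v - height o w := by
  rw [sub_eq_add_neg, height_add, height_neg, sub_eq_add_neg]

@[simp]
theorem height_zero : height o 0 = 0 := by simp [height]

@[simp]
theorem height_simpleRoot (i : Fin n) : height o (simpleRoot i) = o i := by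
  simp [height, simpleRoot_apply]

variable {o} in
@[fun_prop]
theorem continuous_height {X : Type*} [TopologicalSpace X] {f : X → V n} (hf : Continuous f) :
    Continuous fun x => height o (f x) := by
  unfold height
  fun_prop

theorem normalize_smul {a : ℝ} (ha : a ≠ 0) (v : V n) : normalize o (a • v) = normalize o v := by
  rw [normalize, normalize, height_smul, smul_smul, mul_inv, mul_comm a⁻¹, mul_assoc,
    inv_mul_cancel₀ ha, mul_one]

variable {o}

theorem height_normalize {v : V n} (hv : height o v ≠ 0) : height o (normalize o v) = 1 := by
  rw [normalize, height_smul, inv_mul_cancel₀ hv]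

theorem normalize_eq_self {v : V n} (hv : height o v = 1) : normalize o v = v := by
  rw [normalize, hv, inv_one, one_smul]

theorem height_smul_normalize {v : V n} (hv : height o v ≠ 0) :
    height o v • normalize o v = v := by
  rw [normalize, smul_smul, mul_inv_cancel₀ hv, one_smul]

/-- In barycentric coordinates, a point of `V₁` lies in the simplex exactly when all its
coordinates `o_i x_i` are nonnegative. -/
theorem mem_simplex_iff (ho : ∀ i, o i ≠ 0) {x : V n} :
    x ∈ simplex o ↔ height o x = 1 ∧ ∀ i, 0 ≤ o i * x i := by
  constructor
  · intro hx
    have hconv : Convex ℝ {x : V n | height o x = 1 ∧ ∀ i, 0 ≤ o i * x i} := by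
      intro x hx y hy a b ha hb hab
      refine ⟨by simp [hx.1, hy.1, hab], fun i => ?_⟩
      have h1 := mul_nonneg ha (hx.2 i)
      have h2 := mul_nonneg hb (hy.2 i)
      simp only [PiLp.add_apply, PiLp.smul_apply, smul_eq_mul]
      linarith
    refine convexHull_min ?_ hconv hx
    rintro _ ⟨i, rfl⟩
    refine ⟨height_normalize (by simpa using ho i), fun j => ?_⟩
    simp only [normalize, height_simpleRoot, PiLp.smul_apply, simpleRoot_apply, smul_eq_mul]
    split_ifs with h
    · subst h
      simp [ho]
    · simp
  · rintro ⟨h1, h2⟩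
    have h3 : ∑ i, (o i * x i) • normalize o (simpleRoot i) = x := by
      conv_rhs => rw [← sum_smul_simpleRoot x]
      refine Finset.sum_congr rfl fun i _ => ?_
      rw [normalize, height_simpleRoot, smul_smul, mul_comm (o i), mul_assoc,
        mul_inv_cancel₀ (ho i), mul_one]
    rw [← h3]
    exact (convex_convexHull ℝ _).sum_mem (fun i _ => h2 i) h1
      fun i _ => subset_convexHull ℝ _ ⟨i, rfl⟩

theorem isCompact_simplex : IsCompact (simplex o) :=
  (finite_range _).isCompact_convexHull ℝ

end Height

/-! ### The form of signature `(n - 1, 1)` -/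

/-- `o` spans a negative line for the symmetric form `B`, its `B`-orthogonal complement is the
kernel of the height function, and `B` is positive definite there; `c = B(o, o)`. -/
structure IsTimelikeAxis (B : Matrix (Fin n) (Fin n) ℝ) (o : V n) (c : ℝ) : Prop where
  neg : c < 0
  height_self : height o o = 1
  comm : ∀ x y, form B x y = form B y x
  form_axis : ∀ v, form B o v = c * height o v
  pos : ∀ u, height o u = 0 → u ≠ 0 → 0 < form B u u

variable {M : CoxeterMatrix (Fin n)} {B : Matrix (Fin n) (Fin n) ℝ} {o : V n}

theorem IsCoxeterForm.exists_isTimelikeAxis (hB : IsCoxeterForm M B)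
    (hsig : HasSignature B (n - 1) 1) (ho : IsUnitNegEigenvector B o) :
    ∃ c, IsTimelikeAxis B o c := by
  obtain ⟨hn, c, hc, he⟩ := ho
  have hself : height o o = 1 := by
    have := EuclideanSpace.real_norm_sq_eq o
    rw [hn] at this
    simp only [height, ← pow_two]
    linarith
  have hform : ∀ v, form B o v = c * height o v := by
    intro v
    rw [form_eq_sum_right, height, Finset.mul_sum]
    refine Finset.sum_congr rfl fun j _ => ?_
    have h1 : Matrix.toEuclideanLin B o j = c * o j := by rw [he]; simp
    have h2 : form B o (simpleRoot j) = c * o j := by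
      rw [← h1, form_eq_sum_left]
      simp only [form_simpleRoot, Matrix.ofLp_toLpLin, Matrix.toLin'_apply, Matrix.mulVec,
        dotProduct]
      exact Finset.sum_congr rfl fun i _ => by rw [hB.symm.apply j i, mul_comm]
    rw [h2]
    ring
  refine ⟨c, hc, hself, hB.form_comm, hform, fun u hu hu0 => ?_⟩
  -- Otherwise `o` and `u` span a negative semidefinite plane, too large for the signature.
  by_contra hneg
  push Not at hneg
  have hind : LinearIndependent ℝ ![o, u] := by
    rw [LinearIndependent.pair_iff]
    intro s t hst
    have h1 := congrArg (height o) hst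
    simp only [height_add, height_smul, hself, hu, height_zero, mul_one, mul_zero, add_zero] at h1
    subst h1
    simpa [hu0] using hst
  have hrank := finrank_span_eq_card hind
  have h2 := QuadraticForm.sigPos_add_finrank_le_of_nonpos (Q := (form B).toQuadraticMap)
    (V := Submodule.span ℝ (range ![o, u])) (by
      intro x hx
      rw [Matrix.range_cons_cons_empty, Submodule.mem_span_pair] at hx
      obtain ⟨s, t, rfl⟩ := hx
      have h3 : form B u o = 0 := by rw [hB.form_comm, hform, hu, mul_zero]
      have h4 : form B o u = 0 := by rw [hform, hu, mul_zero]
      have h5 : form B o o = c := by rw [hform, hself, mul_one]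
      simp only [LinearMap.BilinMap.toQuadraticMap_apply, map_add, map_smul, LinearMap.add_apply,
        LinearMap.smul_apply, smul_eq_mul, h3, h4, h5]
      nlinarith [mul_nonneg (sq_nonneg s) (neg_nonneg.2 hc.le),
        mul_nonneg (sq_nonneg t) (neg_nonneg.2 hneg)])
  rw [hrank, hsig.1, finrank_euclideanSpace] at h2
  simp only [Fintype.card_fin] at h2
  omega

theorem IsCoxeterForm.neg_of_ne_two (hB : IsCoxeterForm M B) {i j : Fin n} (hij : i ≠ j)
    (h2 : M i j ≠ 2) : B i j < 0 := by
  by_cases h0 : M i j = 0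
  · linarith [hB.infinite_entry i j h0]
  · have h1 := M.off_diagonal i j hij
    have h3 : (2 : ℝ) < M i j := by exact_mod_cast (by omega : 2 < M i j)
    rw [hB.finite_entry i j h0, neg_lt_zero]
    have h4 : Real.pi / M i j < Real.pi / 2 :=
      div_lt_div_of_pos_left Real.pi_pos (by norm_num) h3
    have h5 : 0 ≤ Real.pi / M i j := by positivity
    exact Real.cos_pos_of_mem_Ioo ⟨by linarith [Real.pi_pos], h4⟩

/-- A Perron-Frobenius statement: since the off-diagonal entries of `B` are nonpositive, the vector
of absolute values of `o` has Rayleigh quotient at most that of `o`, so it is proportional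
to `o`; irreducibility then excludes zero entries. -/
theorem IsTimelikeAxis.pos_or_neg {c : ℝ} (h : IsTimelikeAxis B o c) (hB : IsCoxeterForm M B)
    (hirr : IsIrreducible M) : (∀ i, 0 < o i) ∨ ∀ i, o i < 0 := by
  set a : V n := WithLp.toLp 2 fun i => |o i| with ha
  have hai : ∀ i, a i = |o i| := fun i => rfl
  have h1 : form B a a ≤ c := by
    have h2 : form B o o = c := by rw [h.form_axis, h.height_self, mul_one]
    rw [← h2, form_eq_sum, form_eq_sum]
    refine Finset.sum_le_sum fun i _ => Finset.sum_le_sum fun j _ => ?_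
    rw [hai, hai, ← mul_assoc, ← mul_assoc, ← abs_mul]
    rcases eq_or_ne i j with rfl | hij
    · rw [abs_mul_self]
    · exact mul_le_mul_of_nonpos_right (le_abs_self _) (hB.nonpos_of_ne hij)
  set t := height o a with ht
  have ht1 : t ^ 2 ≤ 1 := by
    rw [sq_le_one_iff_abs_le_one, ht, ← h.height_self, height, height]
    refine (Finset.abs_sum_le_sum_abs _ _).trans (Finset.sum_le_sum fun i _ => ?_)
    rw [abs_mul, hai, abs_abs, abs_mul_abs_self]
  have hu : a - t • o = 0 := by
    by_contra hne
    have h2 := h.pos (a - t • o) (by simp [h.height_self, ht]) hne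
    have h3 : form B a o = c * t := by rw [h.comm, h.form_axis]
    simp only [map_sub, map_smul, LinearMap.sub_apply, LinearMap.smul_apply, smul_eq_mul,
      h.form_axis, h3, h.height_self, ← ht] at h2
    nlinarith [h.neg, mul_nonneg (neg_nonneg.2 h.neg.le) (sub_nonneg.2 ht1)]
  have hat : ∀ i, |o i| = t * o i := fun i => by
    have := congrFun (congrArg WithLp.ofLp (sub_eq_zero.1 hu)) i
    simpa [ha] using this
  have hne : ∀ i, o i ≠ 0 := by
    intro i hi
    obtain ⟨i, hi, j, hj, hij⟩ := hirr {i | o i = 0} ⟨i, hi⟩ (by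
      by_contra hempty
      rw [not_nonempty_iff_eq_empty, compl_empty_iff] at hempty
      have hz : ∀ i, o i = 0 := fun i => (hempty.symm ▸ mem_univ i : i ∈ {i | o i = 0})
      have := h.height_self
      simp [height, hz] at this)
    have hij' : i ≠ j := fun h' => hj (h' ▸ hi)
    have hi0 : o i = 0 := hi
    have h2 : form B (simpleRoot i) a = 0 := by
      rw [sub_eq_zero.1 hu, map_smul, h.comm, h.form_axis, height_simpleRoot, hi0]
      simp
    rw [form_eq_sum_right] at h2
    simp only [form_simpleRoot] at h2
    have h3 := (Finset.sum_eq_zero_iff_of_nonpos (fun k _ => by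
      rcases eq_or_ne i k with rfl | hik
      · simp [hai, hi0]
      · exact mul_nonpos_of_nonneg_of_nonpos (by rw [hai]; positivity) (hB.nonpos_of_ne hik))).1
          h2 j (Finset.mem_univ j)
    rcases mul_eq_zero.1 h3 with h4 | h4
    · rw [hai, abs_eq_zero] at h4
      exact hj h4
    · exact (hB.neg_of_ne_two hij' hij).ne h4
  have hpos : ∀ i, 0 < t * o i := fun i => by rw [← hat]; exact abs_pos.2 (hne i)
  rcases le_total 0 t with h0 | h0
  · exact Or.inl fun i => pos_of_mul_pos_right (hpos i) h0
  · exact Or.inr fun i => neg_of_mul_pos_right (hpos i) h0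

/-! ### The isotropic cone and the action of `W` on it -/

namespace IsTimelikeAxis

variable {c : ℝ}

theorem height_ne_zero (h : IsTimelikeAxis B o c) {x : V n} (hx : form B x x = 0)
    (hx0 : x ≠ 0) : height o x ≠ 0 :=
  fun h0 => (h.pos x h0 hx0).ne' hx

theorem height_ne_zero_of_mem (h : IsTimelikeAxis B o c) {x : V n} (hx : x ∈ isotropic B o)
    (g : V n ≃ₗ[ℝ] V n) (hg : form B (g x) (g x) = form B x x) : height o (g x) ≠ 0 := by
  refine h.height_ne_zero (hg.trans hx.2) fun h0 => ?_
  rw [LinearEquiv.map_eq_zero_iff] at h0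
  have := hx.1
  simp [V₁, h0] at this

theorem _root_.CoxeterRoots.normalize_mem_isotropic {x : V n} (hx : form B x x = 0)
    (hx0 : height o x ≠ 0) : normalize o x ∈ isotropic B o :=
  ⟨height_normalize hx0, by simp [normalize, hx]⟩

theorem form_sub_self (h : IsTimelikeAxis B o c) {x y : V n} (hx : x ∈ isotropic B o)
    (hy : y ∈ isotropic B o) : form B (x - y) (x - y) = -2 * form B x y := by
  simp only [map_sub, LinearMap.sub_apply, hx.2, hy.2, h.comm y x]
  ring

theorem form_nonpos (h : IsTimelikeAxis B o c) {x y : V n} (hx : x ∈ isotropic B o)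
    (hy : y ∈ isotropic B o) : form B x y ≤ 0 := by
  have h1 := h.form_sub_self hx hy
  have hx1 : height o x = 1 := hx.1
  have hy1 : height o y = 1 := hy.1
  by_cases hxy : x - y = 0
  · rw [hxy] at h1
    simp at h1
    exact h1.le
  · have := h.pos (x - y) (by simp [hx1, hy1]) hxy
    linarith

/-- Orthogonal isotropic vectors are proportional. -/
theorem eq_of_form_eq_zero (h : IsTimelikeAxis B o c) {x y : V n} (hx : x ∈ isotropic B o)
    (hy : y ∈ isotropic B o) (hxy : form B x y = 0) : x = y := by
  by_contra hne
  have hx1 : height o x = 1 := hx.1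
  have hy1 : height o y = 1 := hy.1
  have := h.pos (x - y) (by simp [hx1, hy1]) (sub_ne_zero.2 hne)
  rw [h.form_sub_self hx hy, hxy] at this
  simp at this

/-- Simple reflections preserve the two halves of the isotropic cone. -/
theorem height_simpleReflection_pos (h : IsTimelikeAxis B o c) (hB : IsCoxeterForm M B)
    {x : V n} (hx : form B x x = 0) (hx0 : 0 < height o x) (i : Fin n) :
    0 < height o (simpleReflection hB i x) := by
  set y := simpleReflection hB i x with hy
  have hyy : form B y y = 0 := by rw [hy, form_simpleReflection, hx]
  have hy0 : y ≠ 0 := fun h0 => by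
    rw [hy, LinearEquiv.map_eq_zero_iff] at h0
    simp [h0] at hx0
  have hyn := h.height_ne_zero hyy hy0
  by_contra hneg
  have hneg : height o y < 0 := lt_of_le_of_ne (not_lt.1 hneg) hyn
  have h1 := h.form_nonpos (normalize_mem_isotropic hx hx0.ne') (normalize_mem_isotropic hyy hyn)
  have h2 : form B x y = height o x * height o y * form B (normalize o x) (normalize o y) := by
    conv_lhs => rw [← height_smul_normalize hx0.ne', ← height_smul_normalize hyn]
    simp only [map_smul, LinearMap.smul_apply, smul_eq_mul]
    ring
  have h3 : form B x y = -2 * form B (simpleRoot i) x ^ 2 := by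
    rw [hy, simpleReflection_eq, map_sub, map_smul, hx, hB.form_comm x (simpleRoot i), smul_eq_mul]
    ring
  have h4 : 0 ≤ form B x y := by
    rw [h2]
    exact mul_nonneg_of_nonpos_of_nonpos (mul_nonpos_of_nonneg_of_nonpos hx0.le hneg.le) h1
  have h5 : form B (simpleRoot i) x = 0 := by
    have : form B (simpleRoot i) x ^ 2 ≤ 0 := by linarith
    exact pow_eq_zero_iff two_ne_zero |>.1 (le_antisymm this (sq_nonneg _))
  rw [hy, simpleReflection_eq, h5] at hneg
  simp at hneg
  linarith

variable {W : Type*} [Group W]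

theorem height_action_pos (h : IsTimelikeAxis B o c) (cs : CoxeterSystem M W)
    (hB : IsCoxeterForm M B) {x : V n} (hx : form B x x = 0) (hx0 : 0 < height o x) (w : W) :
    0 < height o (action cs hB w x) := by
  induction w using cs.simple_induction_left with
  | one => simpa
  | mul_simple_left w i ih =>
    rw [map_mul, LinearEquiv.mul_apply, action_simple]
    exact h.height_simpleReflection_pos hB (by rw [form_action, hx]) ih i

theorem height_action_ne_zero (h : IsTimelikeAxis B o c) (cs : CoxeterSystem M W)
    (hB : IsCoxeterForm M B) {x : V n} (hx : x ∈ isotropic B o) (w : W) :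
    height o (action cs hB w x) ≠ 0 :=
  h.height_ne_zero_of_mem hx _ (form_action cs hB w x x)

theorem normalizedAction_mem (h : IsTimelikeAxis B o c) (cs : CoxeterSystem M W)
    (hB : IsCoxeterForm M B) {x : V n} (hx : x ∈ isotropic B o) (w : W) :
    normalizedAction cs hB o w x ∈ isotropic B o :=
  normalize_mem_isotropic ((form_action cs hB w x x).trans hx.2) (h.height_action_ne_zero cs hB hx w)

theorem normalizedAction_mul (h : IsTimelikeAxis B o c) (cs : CoxeterSystem M W)
    (hB : IsCoxeterForm M B) {x : V n} (hx : x ∈ isotropic B o) (w w' : W) :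
    normalizedAction cs hB o w (normalizedAction cs hB o w' x) =
      normalizedAction cs hB o (w * w') x := by
  rw [normalizedAction, normalizedAction, normalizedAction, map_mul, LinearEquiv.mul_apply]
  conv_lhs => rw [normalize.eq_1 o (action cs hB w' x), map_smul]
  exact normalize_smul o (inv_ne_zero (h.height_action_ne_zero cs hB hx w')) _

theorem _root_.CoxeterRoots.normalizedAction_one (cs : CoxeterSystem M W)
    (hB : IsCoxeterForm M B) {x : V n} (hx : x ∈ isotropic B o) :
    normalizedAction cs hB o 1 x = x := by
  rw [normalizedAction, map_one]
  exact normalize_eq_self hx.1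

theorem normalizedAction_inv (h : IsTimelikeAxis B o c) (cs : CoxeterSystem M W)
    (hB : IsCoxeterForm M B) {x : V n} (hx : x ∈ isotropic B o) (w : W) :
    normalizedAction cs hB o w⁻¹ (normalizedAction cs hB o w x) = x := by
  rw [h.normalizedAction_mul cs hB hx, inv_mul_cancel, normalizedAction_one cs hB hx]

end IsTimelikeAxis

end

section

variable {n : ℕ} {M : CoxeterMatrix (Fin n)} {B : Matrix (Fin n) (Fin n) ℝ} {o : V n}
  {W : Type*} [Group W]

/-! ### Discreteness of the root system -/

theorem form_self_of_mem_roots (cs : CoxeterSystem M W) (hB : IsCoxeterForm M B) {ρ : V n}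
    (hρ : ρ ∈ roots cs hB) : form B ρ ρ = 1 := by
  obtain ⟨w, i, rfl⟩ := hρ
  rw [form_action, form_simpleRoot, hB.diag]

theorem simpleRoot_mem_roots (cs : CoxeterSystem M W) (hB : IsCoxeterForm M B) (i : Fin n) :
    simpleRoot i ∈ roots cs hB :=
  ⟨1, i, by simp⟩

theorem action_mem_roots (cs : CoxeterSystem M W) (hB : IsCoxeterForm M B) (w : W) {ρ : V n}
    (hρ : ρ ∈ roots cs hB) : action cs hB w ρ ∈ roots cs hB := by
  obtain ⟨w', i, rfl⟩ := hρ
  exact ⟨w * w', i, by rw [map_mul, LinearEquiv.mul_apply]⟩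

/-- The `B`-reflection in a root is the action of an element of `W`. -/
theorem exists_action_eq_reflection (cs : CoxeterSystem M W) (hB : IsCoxeterForm M B) {ρ : V n}
    (hρ : ρ ∈ roots cs hB) :
    ∃ t : W, ∀ v, action cs hB t v = v - (2 * form B ρ v) • ρ := by
  obtain ⟨w, i, rfl⟩ := hρ
  refine ⟨w * cs.simple i * w⁻¹, fun v => ?_⟩
  have h1 : action cs hB w (action cs hB w⁻¹ v) = v := by
    rw [← LinearEquiv.mul_apply, ← map_mul, mul_inv_cancel, map_one]; rfl
  rw [map_mul, map_mul, LinearEquiv.mul_apply, LinearEquiv.mul_apply, action_simple,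
    simpleReflection_eq, map_sub, map_smul, h1]
  conv_rhs => rw [← h1, form_action, h1]

/-- A bounded set contains only finitely many roots: if two roots `ρ, ρ'` are close to each other,
then the product of their reflections is close to the identity, hence trivial. -/
theorem finite_roots_norm_le (cs : CoxeterSystem M W) (hB : IsCoxeterForm M B) (R : ℝ) :
    {ρ ∈ roots cs hB | ‖ρ‖ ≤ R}.Finite := by
  by_contra hinf
  obtain ⟨ξ, -, hξ⟩ := Set.Infinite.exists_accPt_of_subset_isCompact hinf
    (isCompact_closedBall (0 : V n) R) (fun ρ hρ => by simpa using hρ.2)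
  have hξ1 : form B ξ ξ = 1 := by
    have hcl : IsClosed {x : V n | form B x x = 1} :=
      isClosed_eq (by fun_prop) continuous_const
    exact hcl.closure_subset_iff.2 (fun ρ hρ => form_self_of_mem_roots cs hB hρ.1)
      (mem_closure_iff_clusterPt.2 hξ.clusterPt)
  let r : V n → V n → V n := fun ρ v => v - (2 * form B ρ v) • ρ
  let O : Set (V n × V n) := {p | 0 < form B p.1 p.2 ∧
    ∀ i, 0 < r p.1 (r p.2 (simpleRoot i)) i}
  have hO : IsOpen O := by
    have h1 : O = {p | 0 < form B p.1 p.2} ∩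
        ⋂ i, {p : V n × V n | 0 < r p.1 (r p.2 (simpleRoot i)) i} := by
      ext p; simp [O]
    rw [h1]
    refine (isOpen_lt continuous_const (by fun_prop)).inter
      (isOpen_iInter_of_finite fun i => isOpen_lt continuous_const ?_)
    simp only [r]
    fun_prop
  have hmem : (ξ, ξ) ∈ O := by
    refine ⟨by simp [hξ1], fun i => ?_⟩
    have h2 : r ξ (r ξ (simpleRoot i)) = simpleRoot i := by
      simp only [r, map_sub, map_smul, hξ1, smul_eq_mul]
      module
    change 0 < r ξ (r ξ (simpleRoot i)) i
    rw [h2, simpleRoot_apply, if_pos rfl]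
    exact one_pos
  obtain ⟨U₁, hU₁, U₂, hU₂, hU⟩ := mem_nhds_prod_iff.1 (hO.mem_nhds hmem)
  rw [accPt_iff_nhds] at hξ
  obtain ⟨ρ, ⟨hρU, hρ, -⟩, hρξ⟩ := hξ U₁ hU₁
  obtain ⟨ρ', ⟨⟨hρU', hne⟩, hρ', -⟩, -⟩ :=
    hξ (U₂ ∩ {ρ}ᶜ) (inter_mem hU₂ (isOpen_compl_singleton.mem_nhds hρξ.symm))
  obtain ⟨hpos, hcoord⟩ := hU (mk_mem_prod hρU hρU')
  obtain ⟨t, ht⟩ := exists_action_eq_reflection cs hB hρ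
  obtain ⟨t', ht'⟩ := exists_action_eq_reflection cs hB hρ'
  have h1 : t * t' = 1 := by
    refine eq_one_of_forall_pos cs hB fun i => ?_
    rw [map_mul, LinearEquiv.mul_apply, ht, ht']
    exact hcoord i
  have h2 : action cs hB t (action cs hB t' ρ') = ρ' := by
    rw [← LinearEquiv.mul_apply, ← map_mul, h1, map_one]; rfl
  have hρ1 := form_self_of_mem_roots cs hB hρ
  have hρ1' := form_self_of_mem_roots cs hB hρ'
  -- Equality of the two reflections makes `ρ'` a multiple of `ρ`.
  have h3 : ρ' = form B ρ ρ' • ρ := by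
    rw [ht', hρ1', show ρ' - (2 * (1 : ℝ)) • ρ' = -ρ' by module, map_neg, ht] at h2
    have h4 : (2 : ℝ) • ρ' = (2 : ℝ) • (form B ρ ρ' • ρ) := by
      rw [smul_smul, ← sub_eq_zero]
      have h5 := sub_eq_zero.2 h2
      rw [← h5]
      have h6 : (2 : ℝ) • ρ' - (2 * form B ρ ρ') • ρ =
        -(-(ρ' - (2 * form B ρ ρ') • ρ) - ρ') := by module
      rw [h6, h5, neg_zero]
    exact smul_right_injective _ two_ne_zero h4
  have h4 : form B ρ ρ' ^ 2 = 1 := by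
    rw [h3] at hρ1'
    simp only [map_smul, LinearMap.smul_apply, smul_eq_mul, hρ1] at hρ1'
    simp only [mul_one] at hρ1'
    linarith
  have h5 : form B ρ ρ' = 1 := by
    have hpos' : 0 < form B ρ ρ' := hpos
    nlinarith
  rw [h5, one_smul] at h3
  exact hne h3

/-! ### Limit roots -/

section LimitRoots

variable {c : ℝ} (cs : CoxeterSystem M W) (hB : IsCoxeterForm M B)

theorem ne_zero_of_mem_roots {ρ : V n} (hρ : ρ ∈ roots cs hB) : ρ ≠ 0 := by
  rintro rfl
  have := form_self_of_mem_roots cs hB hρ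
  simp at this

theorem height_ne_zero_of_mem_roots (hpos : ∀ i, 0 < o i) {ρ : V n} (hρ : ρ ∈ roots cs hB) :
    height o ρ ≠ 0 := by
  have h0 := ne_zero_of_mem_roots cs hB hρ
  intro hh
  apply h0
  ext l
  rcases roots_nonneg_or_nonpos cs hB hρ with h | h
  · have := (Finset.sum_eq_zero_iff_of_nonneg fun i _ => mul_nonneg (hpos i).le (h i)).1 hh l
      (Finset.mem_univ l)
    simpa [(hpos l).ne'] using this
  · have := (Finset.sum_eq_zero_iff_of_nonpos fun i _ =>
      mul_nonpos_of_nonneg_of_nonpos (hpos i).le (h i)).1 hh l (Finset.mem_univ l)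
    simpa [(hpos l).ne'] using this

theorem normalize_mem_simplex_of_mem_roots (hpos : ∀ i, 0 < o i) {ρ : V n}
    (hρ : ρ ∈ roots cs hB) : normalize o ρ ∈ simplex o := by
  have h0 := height_ne_zero_of_mem_roots cs hB hpos hρ
  rw [mem_simplex_iff fun i => (hpos i).ne']
  refine ⟨height_normalize h0, fun i => mul_nonneg (hpos i).le ?_⟩
  simp only [normalize, PiLp.smul_apply, smul_eq_mul]
  rcases roots_nonneg_or_nonpos cs hB hρ with h | h
  · exact mul_nonneg (inv_nonneg.2 (Finset.sum_nonneg fun i _ =>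
      mul_nonneg (hpos i).le (h i))) (h i)
  · exact mul_nonneg_of_nonpos_of_nonpos (inv_nonpos.2 (Finset.sum_nonpos fun i _ =>
      mul_nonpos_of_nonneg_of_nonpos (hpos i).le (h i))) (h i)

theorem form_normalize_self (ρ : V n) :
    form B (normalize o ρ) (normalize o ρ) = (height o ρ)⁻¹ ^ 2 * form B ρ ρ := by
  simp only [normalize, map_smul, LinearMap.smul_apply, smul_eq_mul]
  ring

/-- The norm of a root is bounded by a multiple of its height. -/
theorem exists_norm_le_mul_abs_height (hpos : ∀ i, 0 < o i) :
    ∃ K > 0, ∀ ρ ∈ roots cs hB, ‖ρ‖ ≤ K * |height o ρ| := by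
  obtain ⟨K, hK, h⟩ := (isCompact_simplex (o := o)).isBounded.exists_pos_norm_le
  refine ⟨K, hK, fun ρ hρ => ?_⟩
  have h0 := height_ne_zero_of_mem_roots cs hB hpos hρ
  conv_lhs => rw [← height_smul_normalize h0]
  rw [norm_smul, Real.norm_eq_abs, mul_comm]
  exact mul_le_mul_of_nonneg_right (h _ (normalize_mem_simplex_of_mem_roots cs hB hpos hρ))
    (abs_nonneg _)

theorem limitRoots_subset_simplex (hpos : ∀ i, 0 < o i) :
    limitRoots cs hB o ⊆ simplex o := by
  intro x hx
  have h1 : normalize o '' roots cs hB ⊆ simplex o := by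
    rintro _ ⟨ρ, hρ, rfl⟩
    exact normalize_mem_simplex_of_mem_roots cs hB hpos hρ
  exact isCompact_simplex.isClosed.closure_subset_iff.2 h1
    (mem_closure_iff_clusterPt.2 (AccPt.clusterPt hx))

/-- Limit roots are isotropic, because the heights of the roots tend to infinity. -/
theorem limitRoots_subset_isotropic (hpos : ∀ i, 0 < o i) :
    limitRoots cs hB o ⊆ isotropic B o := by
  intro x hx
  refine ⟨((mem_simplex_iff fun i => (hpos i).ne').1
    (limitRoots_subset_simplex cs hB hpos hx)).1, ?_⟩
  obtain ⟨K, hK, hKρ⟩ := exists_norm_le_mul_abs_height cs hB hpos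
  have key : ∀ N : ℕ, 0 < N → 0 ≤ form B x x ∧ form B x x * N ^ 2 ≤ K ^ 2 := by
    intro N hN
    have hN' : (0 : ℝ) < N := by exact_mod_cast hN
    have hsplit : normalize o '' roots cs hB =
        normalize o '' {ρ ∈ roots cs hB | ‖ρ‖ ≤ N} ∪
          normalize o '' {ρ ∈ roots cs hB | N < ‖ρ‖} := by
      rw [← image_union]
      congr 1
      ext ρ
      simp only [mem_union, mem_ofPred_eq, ← and_or_left, le_or_gt, and_true]
    have hx' : AccPt x (𝓟 (normalize o '' roots cs hB)) := hx
    rw [hsplit, ← sup_principal, accPt_sup] at hx'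
    have h1 : AccPt x (𝓟 (normalize o '' {ρ ∈ roots cs hB | N < ‖ρ‖})) :=
      hx'.resolve_left fun h =>
        Set.Infinite.of_accPt h ((finite_roots_norm_le cs hB N).image _)
    have hcl : IsClosed {y : V n | 0 ≤ form B y y ∧ form B y y * N ^ 2 ≤ K ^ 2} := by
      rw [ofPred_and]
      exact (isClosed_le (by fun_prop) (by fun_prop)).inter
        (isClosed_le (by fun_prop) (by fun_prop))
    refine hcl.closure_subset_iff.2 ?_ (mem_closure_iff_clusterPt.2 h1.clusterPt)
    rintro _ ⟨ρ, ⟨hρ, hNρ⟩, rfl⟩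
    have h2 := hKρ ρ hρ
    have h3 : 0 < |height o ρ| := abs_pos.2 (height_ne_zero_of_mem_roots cs hB hpos hρ)
    rw [mem_ofPred_eq, form_normalize_self, form_self_of_mem_roots cs hB hρ, mul_one]
    refine ⟨sq_nonneg _, ?_⟩
    rw [← mul_pow, sq_le_sq, abs_mul, abs_inv, abs_of_pos hK, abs_of_pos hN',
      inv_mul_le_iff₀ h3]
    linarith
  by_contra hne
  have h0 : 0 < form B x x := lt_of_le_of_ne (key 1 one_pos).1 (Ne.symm hne)
  obtain ⟨N, hN⟩ := exists_nat_gt (K ^ 2 / form B x x)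
  rw [div_lt_iff₀ h0] at hN
  have h1 := (key (N + 1) (Nat.succ_pos _)).2
  push_cast at h1
  have hN0 : (0 : ℝ) ≤ N := Nat.cast_nonneg N
  nlinarith [mul_nonneg h0.le (sq_nonneg (N : ℝ)), mul_nonneg h0.le hN0]

/-- Normalized roots are never isotropic, so that for isotropic points accumulation points and
adherent points of the set of normalized roots are the same. -/
theorem mem_limitRoots_iff (hpos : ∀ i, 0 < o i) {x : V n} (hx : x ∈ isotropic B o) :
    x ∈ limitRoots cs hB o ↔ x ∈ closure (normalize o '' roots cs hB) := by
  rw [limitRoots, mem_ofPred_eq, accPt_principal_iff_clusterPt, ← mem_closure_iff_clusterPt,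
    sdiff_singleton_eq_self]
  rintro ⟨ρ, hρ, rfl⟩
  have h1 := hx.2
  rw [form_normalize_self, form_self_of_mem_roots cs hB hρ, mul_one] at h1
  exact inv_ne_zero (height_ne_zero_of_mem_roots cs hB hpos hρ) (by simpa using h1)

theorem normalizedAction_mem_limitRoots (h : IsTimelikeAxis B o c) (hpos : ∀ i, 0 < o i)
    {x : V n} (hx : x ∈ limitRoots cs hB o) (w : W) :
    normalizedAction cs hB o w x ∈ limitRoots cs hB o := by
  have hxi := limitRoots_subset_isotropic cs hB hpos hx
  rw [mem_limitRoots_iff cs hB hpos (h.normalizedAction_mem cs hB hxi w)]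
  rw [mem_limitRoots_iff cs hB hpos hxi] at hx
  have hlin : Continuous (action cs hB w) :=
    LinearMap.continuous_of_finiteDimensional (action cs hB w).toLinearMap
  have hcont : ContinuousAt (normalizedAction cs hB o w) x := by
    unfold normalizedAction normalize
    exact ((continuous_height hlin).continuousAt.inv₀
      (h.height_action_ne_zero cs hB hxi w)).smul hlin.continuousAt
  refine closure_mono ?_ (mem_closure_image hcont hx)
  rintro _ ⟨_, ⟨ρ, hρ, rfl⟩, rfl⟩
  refine ⟨action cs hB w ρ, action_mem_roots cs hB w hρ, ?_⟩
  rw [normalizedAction, normalize.eq_1 o ρ, map_smul]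
  exact (normalize_smul o (inv_ne_zero (height_ne_zero_of_mem_roots cs hB hpos hρ)) _).symm

/-- If an infinite set of roots has bounded pairing with an isotropic point `x`, then the
normalized roots in it accumulate at `x`: a limit point of them is isotropic and orthogonal
to `x`. -/
theorem mem_limitRoots_of_bounded_form (h : IsTimelikeAxis B o c) (hpos : ∀ i, 0 < o i)
    {x : V n} (hx : x ∈ isotropic B o) {R : Set (V n)} (hR : R ⊆ roots cs hB)
    (hinf : R.Infinite) {C : ℝ} (hC : ∀ ρ ∈ R, |form B ρ x| ≤ C) :
    x ∈ limitRoots cs hB o := by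
  obtain ⟨K, hK, hKρ⟩ := exists_norm_le_mul_abs_height cs hB hpos
  have hex : ∀ N : ℕ, ∃ ρ ∈ R, N < ‖ρ‖ := by
    intro N
    by_contra hc
    push Not at hc
    exact hinf ((finite_roots_norm_le cs hB N).subset fun ρ hρ => ⟨hR hρ, hc ρ hρ⟩)
  choose ρ hρR hρN using hex
  obtain ⟨η, hη, φ, hφ, hlim⟩ := isCompact_simplex.tendsto_subseq fun N =>
    normalize_mem_simplex_of_mem_roots cs hB hpos (hR (hρR N))
  have hinv : Tendsto (fun k => (height o (ρ (φ k)))⁻¹) atTop (𝓝 0) := by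
    refine squeeze_zero_norm' (a := fun k : ℕ => K * (k : ℝ)⁻¹) ?_
      (by simpa using tendsto_inv_atTop_nhds_zero_nat.const_mul K)
    filter_upwards [eventually_gt_atTop 0] with k hk
    have hk' : (0 : ℝ) < k := by exact_mod_cast hk
    have h1 : (k : ℝ) ≤ φ k := by exact_mod_cast hφ.le_apply
    have h2 := hρN (φ k)
    have h3 := hKρ _ (hR (hρR (φ k)))
    have h4 : 0 < |height o (ρ (φ k))| :=
      abs_pos.2 (height_ne_zero_of_mem_roots cs hB hpos (hR (hρR _)))
    rw [Real.norm_eq_abs, abs_inv, ← div_eq_mul_inv, inv_eq_one_div, div_le_div_iff₀ h4 hk']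
    linarith
  have hη1 : form B η η = 0 := by
    have h1 : Tendsto (fun k => form B (normalize o (ρ (φ k))) (normalize o (ρ (φ k)))) atTop
        (𝓝 (form B η η)) :=
      ((continuous_form B continuous_id continuous_id).tendsto η).comp hlim
    refine tendsto_nhds_unique h1 ?_
    simp_rw [form_normalize_self, form_self_of_mem_roots cs hB (hR (hρR _)), mul_one]
    simpa using hinv.pow 2
  have hη2 : form B η x = 0 := by
    have h1 : Tendsto (fun k => form B (normalize o (ρ (φ k))) x) atTop (𝓝 (form B η x)) :=
      ((continuous_form B continuous_id continuous_const).tendsto η).comp hlim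
    refine tendsto_nhds_unique h1 ?_
    simp_rw [normalize, map_smul, LinearMap.smul_apply, smul_eq_mul]
    refine squeeze_zero_norm (a := fun k => |(height o (ρ (φ k)))⁻¹| * C) (fun k => ?_)
      (by simpa using hinv.abs.mul_const C)
    rw [Real.norm_eq_abs, abs_mul]
    exact mul_le_mul_of_nonneg_left (hC _ (hρR _)) (abs_nonneg _)
  have hηi : η ∈ isotropic B o := ⟨((mem_simplex_iff fun i => (hpos i).ne').1 hη).1, hη1⟩
  rw [mem_limitRoots_iff cs hB hpos hx, ← h.eq_of_form_eq_zero hηi hx hη2]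
  exact mem_closure_of_tendsto hlim (Eventually.of_forall fun k => ⟨_, hR (hρR _), rfl⟩)

/-- An isotropic vector in the nonnegative cone spanned by the simple roots which pairs
nonpositively with all of them (it spans the radical of an affine parabolic subsystem) gives a
limit root. -/
theorem normalize_mem_limitRoots_of_form_nonpos (h : IsTimelikeAxis B o c)
    (hpos : ∀ i, 0 < o i) {y : V n} (hy : form B y y = 0) (hy1 : 0 < height o y)
    (hy0 : ∀ i, 0 ≤ y i) (hyα : ∀ i, form B (simpleRoot i) y ≤ 0) :
    normalize o y ∈ limitRoots cs hB o := by
  have horth : ∀ i, y i = 0 ∨ form B (simpleRoot i) y = 0 := by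
    intro i
    rw [form_eq_sum_left] at hy
    exact mul_eq_zero.1 ((Finset.sum_eq_zero_iff_of_nonpos fun i _ =>
      mul_nonpos_of_nonneg_of_nonpos (hy0 i) (hyα i)).1 hy i (Finset.mem_univ i))
  let R : Set (V n) := {ρ ∈ roots cs hB | (∀ i, 0 ≤ ρ i) ∧ ∀ i, y i = 0 → ρ i = 0}
  have hRorth : ∀ ρ ∈ R, form B ρ y = 0 := by
    intro ρ hρ
    rw [form_eq_sum_left]
    refine Finset.sum_eq_zero fun i _ => ?_
    rcases horth i with h1 | h1
    · rw [hρ.2.2 i h1, zero_mul]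
    · rw [h1, mul_zero]
  have hne : R.Nonempty := by
    obtain ⟨i, hi⟩ : ∃ i, y i ≠ 0 := by
      by_contra hc
      push Not at hc
      simp [height, hc] at hy1
    refine ⟨simpleRoot i, simpleRoot_mem_roots cs hB i, fun j => ?_, fun j hj => ?_⟩
    · rw [simpleRoot_apply]; split_ifs <;> norm_num
    · rw [simpleRoot_apply, if_neg]
      rintro rfl
      exact hi hj
  -- A root of maximal height in the subsystem would be orthogonal to the whole subsystem.
  have hinf : R.Infinite := by
    intro hfin
    obtain ⟨ρ, hρ, hmax⟩ := hfin.exists_maximalFor (height o) R hne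
    have hρα : ∀ i, y i ≠ 0 → 0 ≤ form B ρ (simpleRoot i) := by
      intro i hi
      by_contra hneg
      push Not at hneg
      rw [hB.form_comm] at hneg
      have h1 : simpleReflection hB i ρ ∈ R := by
        refine ⟨by rw [← action_simple cs]; exact action_mem_roots cs hB _ hρ.1,
          fun j => ?_, fun j hj => ?_⟩
        · rw [simpleReflection_eq]
          simp only [PiLp.sub_apply, PiLp.smul_apply, smul_eq_mul, simpleRoot_apply]
          have := hρ.2.1 j
          split_ifs <;> linarith
        · rw [simpleReflection_eq]
          simp only [PiLp.sub_apply, PiLp.smul_apply, smul_eq_mul, simpleRoot_apply]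
          rw [hρ.2.2 j hj, if_neg (fun hji : j = i => hi (hji ▸ hj))]
          ring
      have h2 : height o ρ < height o (simpleReflection hB i ρ) := by
        rw [simpleReflection_eq, height_sub, height_smul, height_simpleRoot]
        nlinarith [hpos i]
      exact absurd (hmax h1 h2.le) (not_le.2 h2)
    have h1 := hRorth ρ hρ
    rw [form_eq_sum_right] at h1
    have h2 := (Finset.sum_eq_zero_iff_of_nonneg fun i _ => by
      by_cases hi : y i = 0
      · simp [hi]
      · exact mul_nonneg (hy0 i) (hρα i hi)).1 h1
    have h3 := form_self_of_mem_roots cs hB hρ.1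
    rw [form_eq_sum_right, Finset.sum_eq_zero] at h3
    · exact zero_ne_one h3
    · intro i _
      rcases mul_eq_zero.1 (h2 i (Finset.mem_univ i)) with h4 | h4
      · rw [hρ.2.2 i h4, zero_mul]
      · rw [h4, mul_zero]
  refine mem_limitRoots_of_bounded_form cs hB h hpos (normalize_mem_isotropic hy hy1.ne')
    (fun ρ hρ => hρ.1) hinf (C := 0) fun ρ hρ => ?_
  rw [normalize, map_smul, hRorth ρ hρ, smul_zero, abs_zero]

/-- An isotropic point whose whole orbit stays in the simplex is a limit root. Either infinitely
many points `w(x)` have height at most that of `x`, and then the roots `w⁻¹(α_i)` accumulate at `x`;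
or the height is minimal at some `w(x)`, which then lies in the fundamental chamber. -/
theorem mem_limitRoots_of_forall_mem_simplex (h : IsTimelikeAxis B o c) (hpos : ∀ i, 0 < o i)
    {x : V n} (hx : x ∈ isotropic B o)
    (hxs : ∀ w, normalizedAction cs hB o w x ∈ simplex o) : x ∈ limitRoots cs hB o := by
  have hx1 : height o x = 1 := hx.1
  have hhpos : ∀ w, 0 < height o (action cs hB w x) :=
    h.height_action_pos cs hB hx.2 (by rw [hx1]; exact one_pos)
  let A : Set W := {w | height o (action cs hB w x) ≤ 1}
  have h1A : (1 : W) ∈ A := by simp [A, hx1]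
  by_cases hA : A.Finite
  · obtain ⟨w, hw, hmin⟩ := hA.exists_minimalFor (fun w => height o (action cs hB w x)) A ⟨1, h1A⟩
    have hmin' : ∀ w', height o (action cs hB w x) ≤ height o (action cs hB w' x) := by
      intro w'
      by_cases hw' : w' ∈ A
      · exact le_of_not_gt fun hlt => absurd (hmin hw' hlt.le) (not_le.2 hlt)
      · exact (show height o (action cs hB w x) ≤ 1 from hw).trans (not_le.1 hw').le
    have hmem : normalizedAction cs hB o w x ∈ limitRoots cs hB o := by
      refine normalize_mem_limitRoots_of_form_nonpos cs hB h hpos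
        ((form_action cs hB w x x).trans hx.2) (hhpos w) (fun i => ?_) fun i => ?_
      · have h1 := ((mem_simplex_iff fun i => (hpos i).ne').1 (hxs w)).2 i
        have h2 := nonneg_of_mul_nonneg_right h1 (hpos i)
        simp only [normalizedAction, normalize, PiLp.smul_apply, smul_eq_mul] at h2
        exact nonneg_of_mul_nonneg_right h2 (inv_pos.2 (hhpos w))
      · have h1 := hmin' (cs.simple i * w)
        rw [map_mul, LinearEquiv.mul_apply, action_simple, simpleReflection_eq, height_sub,
          height_smul, height_simpleRoot] at h1
        by_contra hc
        push Not at hc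
        nlinarith [mul_pos hc (hpos i)]
    have h1 := normalizedAction_mem_limitRoots cs hB h hpos hmem w⁻¹
    rwa [h.normalizedAction_inv cs hB hx] at h1
  · obtain ⟨i, hi⟩ : ∃ i, ((fun w => action cs hB w⁻¹ (simpleRoot i)) '' A).Infinite := by
      by_contra hc
      push Not at hc
      refine hA (Set.Finite.of_injOn (f := fun w i => action cs hB w⁻¹ (simpleRoot i))
        (t := Set.univ.pi fun i => (fun w => action cs hB w⁻¹ (simpleRoot i)) '' A)
        (fun w hw i _ => ⟨w, hw, rfl⟩) (fun w _ w' _ hww => ?_) (Set.Finite.pi' hc |>.subset ?_))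
      · exact eq_of_forall_action_inv_eq cs hB fun i => congrFun hww i
      · intro f hf i
        exact hf i (mem_univ i)
    obtain ⟨C, hC⟩ := (isCompact_simplex (o := o)).exists_bound_of_continuousOn
      (f := fun y => form B (simpleRoot i) y) (by fun_prop)
    refine mem_limitRoots_of_bounded_form cs hB h hpos hx
      (R := (fun w => action cs hB w⁻¹ (simpleRoot i)) '' A) ?_ hi (C := C) ?_
    · rintro _ ⟨w, -, rfl⟩
      exact ⟨_, _, rfl⟩
    · rintro _ ⟨w, hw, rfl⟩
      have h1 : form B (action cs hB w⁻¹ (simpleRoot i)) x =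
          form B (simpleRoot i) (action cs hB w x) := by
        rw [← form_action cs hB w, ← LinearEquiv.mul_apply, ← map_mul, mul_inv_cancel, map_one]
        rfl
      have h2 := hC _ (hxs w)
      have h3 : height o (action cs hB w x) ≤ 1 := hw
      simp only
      rw [h1, ← height_smul_normalize (hhpos w).ne', map_smul, smul_eq_mul, abs_mul,
        abs_of_pos (hhpos w)]
      exact (mul_le_of_le_one_left (abs_nonneg _) h3).trans h2

theorem limitRoots_eq_of_pos (h : IsTimelikeAxis B o c) (hpos : ∀ i, 0 < o i) :
    limitRoots cs hB o =
      {x ∈ isotropic B o | ∀ w, normalizedAction cs hB o w x ∈ simplex o} := by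
  ext x
  exact ⟨fun hx => ⟨limitRoots_subset_isotropic cs hB hpos hx, fun w =>
    limitRoots_subset_simplex cs hB hpos (normalizedAction_mem_limitRoots cs hB h hpos hx w)⟩,
    fun hx => mem_limitRoots_of_forall_mem_simplex cs hB h hpos hx.1 hx.2⟩

end LimitRoots

end

section

variable {n : ℕ} {M : CoxeterMatrix (Fin n)} {B : Matrix (Fin n) (Fin n) ℝ} {o : V n}
  {W : Type*} [Group W] {c : ℝ}

/-! ### Independence of the sign of the eigenvector -/

@[simp]
theorem height_neg_left (v : V n) : height (-o) v = -height o v := by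
  simp [height, Finset.sum_neg_distrib]

theorem normalize_neg_left (v : V n) : normalize (-o) v = -normalize o v := by
  rw [normalize, normalize, height_neg_left, inv_neg, neg_smul]

theorem IsTimelikeAxis.neg_axis (h : IsTimelikeAxis B o c) : IsTimelikeAxis B (-o) c where
  neg := h.neg
  height_self := by simp [h.height_self]
  comm := h.comm
  form_axis v := by simp [h.form_axis]
  pos u hu := h.pos u (by simpa using hu)

theorem mem_isotropic_neg {x : V n} : x ∈ isotropic B (-o) ↔ -x ∈ isotropic B o := by
  simp [isotropic, V₁]

theorem mem_simplex_neg (ho : ∀ i, o i ≠ 0) {x : V n} :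
    x ∈ simplex (-o) ↔ -x ∈ simplex o := by
  rw [mem_simplex_iff ho, mem_simplex_iff (fun i => by simpa using ho i)]
  simp

theorem neg_mem_limitRoots_neg (cs : CoxeterSystem M W) (hB : IsCoxeterForm M B) {x : V n}
    (hx : x ∈ limitRoots cs hB o) : -x ∈ limitRoots cs hB (-o) := by
  have h1 := AccPt.map (show AccPt x (𝓟 (normalize o '' roots cs hB)) from hx)
    (f := fun y : V n => -y) continuous_neg.continuousAt neg_injective
  rw [map_principal, image_image] at h1
  simp_rw [← normalize_neg_left] at h1
  exact h1

theorem mem_limitRoots_neg (cs : CoxeterSystem M W) (hB : IsCoxeterForm M B) {x : V n} :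
    x ∈ limitRoots cs hB (-o) ↔ -x ∈ limitRoots cs hB o := by
  constructor
  · intro hx
    simpa using neg_mem_limitRoots_neg cs hB hx
  · intro hx
    simpa using neg_mem_limitRoots_neg cs hB hx

theorem normalizedAction_neg (cs : CoxeterSystem M W) (hB : IsCoxeterForm M B) (w : W)
    (x : V n) : normalizedAction cs hB (-o) w x = -normalizedAction cs hB o w (-x) := by
  rw [normalizedAction, normalizedAction, normalize_neg_left, map_neg,
    ← neg_one_smul ℝ (action cs hB w x), normalize_smul o (by norm_num)]

/-- The limit roots are the isotropic points whose whole orbit stays in the simplex. -/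
theorem limitRoots_eq (cs : CoxeterSystem M W) (hB : IsCoxeterForm M B)
    (h : IsTimelikeAxis B o c) (hsign : (∀ i, 0 < o i) ∨ ∀ i, o i < 0) :
    limitRoots cs hB o =
      {x ∈ isotropic B o | ∀ w, normalizedAction cs hB o w x ∈ simplex o} := by
  rcases hsign with hpos | hneg
  · exact limitRoots_eq_of_pos cs hB h hpos
  · have hpos : ∀ i, 0 < (-o) i := fun i => by simpa using hneg i
    have key := limitRoots_eq_of_pos cs hB h.neg_axis hpos
    ext x
    have h1 := Set.ext_iff.1 key (-x)
    rw [mem_limitRoots_neg, neg_neg] at h1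
    rw [h1]
    simp only [mem_ofPred_eq, mem_isotropic_neg, normalizedAction_neg, neg_neg,
      mem_simplex_neg fun i => (hneg i).ne]

/-! ### Components of the complement of the simplex -/

theorem IsTimelikeAxis.form_self_nonneg (h : IsTimelikeAxis B o c) {u : V n}
    (hu : height o u = 0) : 0 ≤ form B u u := by
  by_cases h0 : u = 0
  · simp [h0]
  · exact (h.pos u hu h0).le

/-- The triangle inequality for the norm induced by `B` on the orthogonal complement of `o`. -/
theorem IsTimelikeAxis.sqrt_form_add_le (h : IsTimelikeAxis B o c) {u v : V n}
    (hu : height o u = 0) (hv : height o v = 0) :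
    √(form B (u + v) (u + v)) ≤ √(form B u u) + √(form B v v) := by
  by_cases hu0 : u = 0
  · simp [hu0]
  by_cases hv0 : v = 0
  · simp [hv0]
  have ha := h.pos u hu hu0
  have hb := h.pos v hv hv0
  have ha' := Real.sqrt_pos.2 ha
  have hb' := Real.sqrt_pos.2 hb
  have ha2 := Real.sq_sqrt ha.le
  have hb2 := Real.sq_sqrt hb.le
  set a := √(form B u u)
  set b := √(form B v v)
  have h1 := h.form_self_nonneg (u := b • u - a • v) (by simp [hu, hv])
  have h2 : form B u v ≤ a * b := by
    simp only [map_sub, map_smul, LinearMap.sub_apply, LinearMap.smul_apply, smul_eq_mul,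
      h.comm v u, ← ha2, ← hb2] at h1
    have h3 : 0 ≤ (2 * (a * b)) * (a * b - form B u v) := by nlinarith
    have h4 := nonneg_of_mul_nonneg_right h3 (by positivity)
    linarith
  apply Real.sqrt_le_iff.2
  refine ⟨by positivity, ?_⟩
  simp only [map_add, LinearMap.add_apply, h.comm v u]
  nlinarith

/-- The part of the isotropic quadric strictly beyond the `i`-th facet of the simplex. It is
connected: the isotropic points are the `o + u / |u|` with `u` orthogonal to `o` (and `|·|` the
norm given by `B`, suitably scaled), and since `o i * o i ≥ 0` the condition on `u` to lie beyond
the facet is a convex one. -/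
theorem IsTimelikeAxis.isPreconnected_cap (h : IsTimelikeAxis B o c) (i : Fin n) :
    IsPreconnected {x ∈ isotropic B o | o i * x i < 0} := by
  let N : V n → ℝ := fun u => √(form B u u) / √(-c)
  have hc : 0 < √(-c) := Real.sqrt_pos.2 (neg_pos.2 h.neg)
  have hNnonneg : ∀ u, 0 ≤ N u := fun u => by positivity
  have hNsmul : ∀ (a : ℝ) u, 0 ≤ a → N (a • u) = a * N u := by
    intro a u ha
    simp only [N, map_smul, LinearMap.smul_apply, smul_eq_mul]
    rw [← mul_assoc, Real.sqrt_mul (mul_nonneg ha ha), Real.sqrt_mul_self ha, mul_div_assoc]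
  have hNadd : ∀ u v, height o u = 0 → height o v = 0 → N (u + v) ≤ N u + N v := by
    intro u v hu hv
    simp only [N]
    rw [← add_div]
    exact div_le_div_of_nonneg_right (h.sqrt_form_add_le hu hv) hc.le
  have hNcont : Continuous N := by
    simp only [N]
    exact (Real.continuous_sqrt.comp (continuous_form B continuous_id continuous_id)).div_const _
  let U : Set (V n) := {u | height o u = 0 ∧ o i * o i * N u + o i * u i < 0}
  have hU : Convex ℝ U := by
    intro u hu v hv a b ha hb hab
    refine ⟨by simp [hu.1, hv.1], ?_⟩
    have h1 := hNadd (a • u) (b • v) (by simp [hu.1]) (by simp [hv.1])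
    rw [hNsmul a u ha, hNsmul b v hb] at h1
    have h2 := mul_le_mul_of_nonneg_left h1 (mul_self_nonneg (o i))
    have hu2 := hu.2
    have hv2 := hv.2
    simp only [PiLp.add_apply, PiLp.smul_apply, smul_eq_mul]
    have h3 : a * (o i * o i * N u + o i * u i) + b * (o i * o i * N v + o i * v i) < 0 := by
      rcases ha.eq_or_lt with rfl | ha
      · have hb1 : b = 1 := by linarith
        simpa [hb1] using hv2
      · exact add_neg_of_neg_of_nonpos (mul_neg_of_pos_of_neg ha hu2)
          (mul_nonpos_of_nonneg_of_nonpos hb hv2.le)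
    nlinarith
  have hUpos : ∀ u ∈ U, 0 < N u := by
    intro u hu
    refine div_pos (Real.sqrt_pos.2 (h.pos u hu.1 ?_)) hc
    rintro rfl
    have := hu.2
    simp [N] at this
  have hN2 : ∀ u, height o u = 0 → form B u u = -c * N u ^ 2 := by
    intro u hu
    simp only [N]
    rw [div_pow, Real.sq_sqrt (h.form_self_nonneg hu), Real.sq_sqrt (neg_pos.2 h.neg).le,
      mul_div_cancel₀ _ (neg_pos.2 h.neg).ne']
  have himage : (fun u => o + (N u)⁻¹ • u) '' U = {x ∈ isotropic B o | o i * x i < 0} := by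
    ext x
    constructor
    · rintro ⟨u, hu, rfl⟩
      have hu0 := hUpos u hu
      refine ⟨⟨by simp [V₁, h.height_self, hu.1], ?_⟩, ?_⟩
      · simp only [map_add, map_smul, LinearMap.add_apply, LinearMap.smul_apply, smul_eq_mul,
          h.form_axis, h.comm u o, hu.1, h.height_self, hN2 u hu.1]
        field_simp
        ring
      · simp only [PiLp.add_apply, PiLp.smul_apply, smul_eq_mul]
        have h1 := mul_neg_of_pos_of_neg (inv_pos.2 hu0) hu.2
        have h2 : (N u)⁻¹ * (o i * o i * N u + o i * u i) =
            o i * (o i + (N u)⁻¹ * u i) := by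
          field_simp
        rwa [h2] at h1
    · rintro ⟨⟨hx1, hx0⟩, hxi⟩
      have hx1 : height o x = 1 := hx1
      have hh : height o (x - o) = 0 := by simp [hx1, h.height_self]
      have h1 : form B (x - o) (x - o) = -c := by
        simp only [map_sub, LinearMap.sub_apply, h.form_axis, h.comm x o, hx0, hx1,
          h.height_self]
        ring
      have h2 : N (x - o) = 1 := by
        simp only [N]
        rw [h1, div_self hc.ne']
      refine ⟨x - o, ⟨hh, ?_⟩, by simp [h2]⟩
      rw [h2]
      simp only [PiLp.sub_apply]
      linarith
  rw [← himage]
  refine hU.isPreconnected.image _ (continuousOn_const.add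
    ((hNcont.continuousOn.inv₀ fun u hu => (hUpos u hu).ne').smul continuousOn_id))

theorem isotropic_diff_simplex (ho : ∀ i, o i ≠ 0) :
    isotropic B o \ simplex o = ⋃ i, {x ∈ isotropic B o | o i * x i < 0} := by
  ext x
  simp only [Set.mem_sdiff, mem_iUnion, mem_ofPred_eq, mem_simplex_iff ho, exists_and_left]
  refine and_congr_right fun hx => ?_
  have hx1 : height o x = 1 := hx.1
  simp [hx1]

/-- A union of `m` preconnected sets has at most `m` connected components. -/
theorem finite_components_of_iUnion {m : ℕ} {A : Set (V n)} {C : Fin m → Set (V n)}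
    (hA : A = ⋃ i, C i) (hC : ∀ i, IsPreconnected (C i)) :
    (components A).Finite ∧ (components A).ncard ≤ m := by
  classical
  let g : Fin m → Set (V n) := fun i =>
    if h : (C i).Nonempty then connectedComponentIn A h.some else ∅
  have hsub : components A ⊆ g '' univ := by
    rintro _ ⟨x, hx, rfl⟩
    rw [hA] at hx
    obtain ⟨i, hi⟩ := mem_iUnion.1 hx
    have hne : (C i).Nonempty := ⟨x, hi⟩
    refine ⟨i, mem_univ i, ?_⟩
    simp only [g, hne, dif_pos]
    exact connectedComponentIn_eq
      ((hC i).subset_connectedComponentIn hne.some_mem (hA ▸ subset_iUnion C i) hi)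
  have hfin : (g '' univ).Finite := finite_univ.image g
  refine ⟨hfin.subset hsub, (ncard_le_ncard hsub hfin).trans
    ((ncard_image_le finite_univ).trans ?_)⟩
  simp [ncard_univ]

theorem sUnion_components (A : Set (V n)) : ⋃₀ components A = A := by
  ext x
  constructor
  · rintro ⟨_, ⟨y, hy, rfl⟩, hx⟩
    exact connectedComponentIn_subset A y hx
  · intro hx
    exact ⟨_, ⟨x, hx, rfl⟩, mem_connectedComponentIn hx⟩

theorem IsTimelikeAxis.mem_orbit_iff (h : IsTimelikeAxis B o c) (cs : CoxeterSystem M W)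
    (hB : IsCoxeterForm M B) {x : V n} (hx : x ∈ isotropic B o) {D : Set (V n)}
    (hD : D ⊆ isotropic B o) :
    x ∈ orbit cs hB o D ↔ ∃ w, normalizedAction cs hB o w x ∈ D := by
  simp only [orbit, mem_iUnion]
  constructor
  · rintro ⟨w, y, hy, rfl⟩
    exact ⟨w⁻¹, by rwa [h.normalizedAction_inv cs hB (hD hy)]⟩
  · rintro ⟨w, hw⟩
    exact ⟨w⁻¹, _, hw, h.normalizedAction_inv cs hB hx w⟩

end

end CoxeterRoots

end

open CoxeterRoots in
theorem mainTheorem1 {n : ℕ} {W : Type*} [Group W] [Infinite W]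
    (M : CoxeterMatrix (Fin n)) (cs : CoxeterSystem M W)
    (hirr : CoxeterRoots.IsIrreducible M)
    (B : Matrix (Fin n) (Fin n) ℝ) (hB : CoxeterRoots.IsCoxeterForm M B)
    (hsig : CoxeterRoots.HasSignature B (n - 1) 1)
    (o : CoxeterRoots.V n) (ho : CoxeterRoots.IsUnitNegEigenvector B o) :
    (CoxeterRoots.isotropic B o ⊆ CoxeterRoots.simplex o →
      CoxeterRoots.limitRoots cs hB o = CoxeterRoots.isotropic B o) ∧
    (¬ CoxeterRoots.isotropic B o ⊆ CoxeterRoots.simplex o →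
      ∃ m : ℕ, 1 ≤ m ∧ m ≤ n ∧ ∃ D : Fin m → Set (CoxeterRoots.V n),
        Function.Injective D ∧
        Set.range D =
          CoxeterRoots.components (CoxeterRoots.isotropic B o \ CoxeterRoots.simplex o) ∧
        CoxeterRoots.limitRoots cs hB o =
          CoxeterRoots.isotropic B o \ ⋃ i, CoxeterRoots.orbit cs hB o (D i)) := by
  obtain ⟨c, h⟩ := hB.exists_isTimelikeAxis hsig ho
  have hsign := h.pos_or_neg hB hirr
  have hne : ∀ i, o i ≠ 0 := fun i => hsign.elim (fun hp => (hp i).ne') fun hn => (hn i).ne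
  have hE := limitRoots_eq cs hB h hsign
  refine ⟨fun hsub => ?_, fun hsub => ?_⟩
  · rw [hE]
    ext x
    exact ⟨fun hx => hx.1, fun hx => ⟨hx, fun w => hsub (h.normalizedAction_mem cs hB hx w)⟩⟩
  · set A := isotropic B o \ simplex o with hA
    obtain ⟨hfin, hcard⟩ := finite_components_of_iUnion (isotropic_diff_simplex (B := B) hne)
      h.isPreconnected_cap
    rw [← hA] at hfin hcard
    have hAne : A.Nonempty := by
      obtain ⟨x, hx, hxs⟩ := not_subset.1 hsub
      exact ⟨x, hx, hxs⟩
    have : Finite (components A) := hfin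
    let e := Finite.equivFin (components A)
    refine ⟨Nat.card (components A), ?_, hcard, fun k => (e.symm k : Set (V n)),
      Subtype.val_injective.comp e.symm.injective, ?_, ?_⟩
    · have hcne : Nonempty (components A) := (hAne.image _).to_subtype
      exact Nat.card_pos
    · change range (Subtype.val ∘ e.symm) = _
      rw [e.symm.surjective.range_comp, Subtype.range_coe]
    · have hU : ∀ y, y ∈ A ↔ ∃ k, y ∈ (e.symm k : Set (V n)) := by
        intro y
        conv_lhs => rw [← sUnion_components A]
        constructor
        · rintro ⟨D, hD, hy⟩
          exact ⟨e ⟨D, hD⟩, (congrArg (y ∈ Subtype.val ·) (e.symm_apply_apply ⟨D, hD⟩)).mpr hy⟩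
        · rintro ⟨k, hk⟩
          exact ⟨_, (e.symm k).2, hk⟩
      have hD : ∀ k, (e.symm k : Set (V n)) ⊆ isotropic B o := fun k y hy =>
        ((hU y).2 ⟨k, hy⟩).1
      rw [hE]
      ext x
      refine and_congr_right fun hx => ?_
      simp only [mem_iUnion, h.mem_orbit_iff cs hB hx (hD _)]
      constructor
      · rintro hs ⟨k, w, hw⟩
        exact ((hU _).2 ⟨k, hw⟩).2 (hs w)
      · intro hn w
        by_contra hc
        obtain ⟨k, hk⟩ := (hU _).1 ⟨h.normalizedAction_mem cs hB hx w, hc⟩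
        exact hn ⟨k, w, hk⟩
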